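/- Let $n\ge 0$, $d\ge 0$ be integers and let $-\pi<\alpha_j\le\beta_j<\pi$ ($1\le j\le d$) be real numbers such that the open intervals $(\alpha_j,\beta_j)$ are pairwise disjoint. Put $$\mathcal I=\bigcup_{j=1}^d[\alpha_j,\beta_j],\qquad \mathcal T=\bigcup_{j=1}^d\{e^{it}: t\in[\alpha_j,\beta_j]\},\qquad \mathcal J=\bigcup_{j=1}^d\Big[\tan\tfrac{\alpha_j}{2},\tan\tfrac{\beta_j}{2}\Big],$$ $f=\mathbf 1_{\mathcal T}$, $\Delta(x_1,\dots,x_n)=\prod_{1\le i<j\le n}(x_i-x_j)$, and $$Z_n(\mathcal I)=\frac{1}{(2\pi)^n n!}\int_{\mathcal I^n}\prod_{1\le i<j\le n}|e^{i\theta_i}-e^{i\theta_j}|^2\,d\theta_1\cdots d\theta_n .$$ Then $Z_n(\mathcal I)$ is equal to each of the following quantities. 1. The Toeplitz integral with symbol $f$: $$\frac{1}{(2\pi)^n n!}\int_{[-\pi,\pi]^n}\Big(\prod_{k=1}^n f(e^{i\theta_k})\Big)\prod_{1\le i<j\le n}|e^{i\theta_i}-e^{i\theta_j}|^2\,d\theta_1\cdots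 d\theta_n .$$ 2. The Toeplitz determinant $\det(t_{i-j})_{1\le i,j\le n}$, where $$t_0=\frac1{2\pi}\sum_{j=1}^d(\beta_j-\alpha_j)=\frac{|\mathcal I|}{2\pi},\qquad t_k=\frac1{2\pi}\sum_{j=1}^d e^{ik\frac{\alpha_j+\beta_j}2}(\beta_j-\alpha_j)\,\mathrm{sinc}\,\frac{k(\beta_j-\alpha_j)}2\quad(k\ne0),$$ with $\mathrm{sinc}\,x=\frac{\sin x}{x}$ for $x\neq 0$ and $\mathrm{sinc}\,0=1$; moreover $t_k=\frac1{2\pi}\int_{-\pi}^{\pi}f(e^{i\theta})e^{ik\theta}\,d\theta$ for every $k\in\mathbb Z$. 3. The real integrals $$\frac{2^{n(n-1)}}{(2\pi)^n n!}\int_{\mathcal I^n}\prod_{1\le i<j\le n}\sin^2\Big(\frac{\theta_i-\theta_j}2\Big)d\theta_1\cdots d\theta_n$$ and $$\frac{2^{n^2}}{(2\pi)^n n!}\int_{\mathcal J^n}\Delta(t_1,\dots,t_n)^2\,e^{-n\sum_{k=1}^n\ln(1+t_k^2)}\,dt_1\cdots dt_n .$$ 4. The Hermitian matrix integral $$c_n\int_{\mathcal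 N_n(\mathcal J)}\frac{dM}{\det(I_n+M^2)^n},$$ where $\mathcal N_n(\mathcal J)$ is the set of $n\times n$ Hermitian matrices all of whose eigenvalues lie in $\mathcal J$, $dM=\prod_i dM_{ii}\prod_{i<j}d\,\mathrm{Re}M_{ij}\,d\,\mathrm{Im}M_{ij}$, and $$c_n=\frac{2^{n^2}}{(2\pi)^n n!}\cdot\frac{n!\prod_{j=1}^{n-1}j!}{\pi^{n(n-1)/2}}=\frac{2^{n(n-1)}}{\pi^{n(n+1)/2}}\prod_{j=1}^{n-1}j!\,.$$ 5. The contour integral $$\frac{1}{(2\pi)^n n!}(-1)^{\frac{n(n+1)}2}\,i^n\int_{\mathcal T^n}\Delta(u_1,\dots,u_n)^2\,e^{-n\sum_{k=1}^n\ln u_k}\,du_1\cdots du_n,$$ each arc of $\mathcal T$ being traversed counterclockwise, and $\ln$ being the principal logarithm. -/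

import Mathlib

open MeasureTheory

noncomputable section

/-- The union of the intervals `[α j, β j]`. -/
def arcAngles {d : ℕ} (α β : Fin d → ℝ) : Set ℝ :=
  ⋃ j, Set.Icc (α j) (β j)

/-- The union of the arcs `{e^{it} : t ∈ [α j, β j]}` of the unit circle. -/
def arcPoints {d : ℕ} (α β : Fin d → ℝ) : Set ℂ :=
  ⋃ j, (fun t : ℝ => Complex.exp (Complex.I * (t : ℂ))) '' Set.Icc (α j) (β j)

/-- The union of the intervals `[tan (α j / 2), tan (β j / 2)]`. -/
def tanIntervals {d : ℕ} (α β : Fin d → ℝ) : Set ℝ :=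
  ⋃ j, Set.Icc (Real.tan (α j / 2)) (Real.tan (β j / 2))

/-- The Vandermonde product `∏_{i<j} (x i - x j)`. -/
def vandermondeProd {R : Type*} [CommRing R] {n : ℕ} (x : Fin n → R) : R :=
  ∏ i, ∏ j ∈ Finset.Ioi i, (x i - x j)

/-- The interaction `∏_{i<j} |e^{iθ_i} - e^{iθ_j}|²`. -/
def circularInteraction {n : ℕ} (θ : Fin n → ℝ) : ℝ :=
  ∏ i, ∏ j ∈ Finset.Ioi i,
    ‖Complex.exp (Complex.I * (θ i : ℂ)) - Complex.exp (Complex.I * (θ j : ℂ))‖ ^ 2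

/-- `Z_n(S) = 1/((2π)^n n!) ∫_{S^n} ∏_{i<j} |e^{iθ_i} - e^{iθ_j}|² dθ`. -/
def circularIntegral (n : ℕ) (S : Set ℝ) : ℝ :=
  1 / ((2 * Real.pi) ^ n * (n.factorial : ℝ)) *
    ∫ θ in Set.univ.pi (fun _ : Fin n => S), circularInteraction θ

/-- The indicator function of the union of arcs. -/
def arcSymbol {d : ℕ} (α β : Fin d → ℝ) : ℂ → ℝ :=
  (arcPoints α β).indicator (fun _ => 1)

/-- The Toeplitz coefficients `t_k`; `Real.sinc x` is `sin x / x` for `x ≠ 0`, and where its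
argument vanishes for `k ≠ 0` it is multiplied by `β j - α j = 0`. -/
def toeplitzCoeff {d : ℕ} (α β : Fin d → ℝ) (k : ℤ) : ℂ :=
  if k = 0 then 1 / (2 * (Real.pi : ℂ)) * ∑ j, ((β j - α j : ℝ) : ℂ)
  else 1 / (2 * (Real.pi : ℂ)) *
    ∑ j, Complex.exp (Complex.I * (k : ℂ) * (((α j + β j) / 2 : ℝ) : ℂ)) *
      ((β j - α j : ℝ) : ℂ) * ((Real.sinc ((k : ℝ) * (β j - α j) / 2) : ℝ) : ℂ)

/-- The Toeplitz matrix `(t_{i-j})`. -/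
def toeplitzMatrix {d : ℕ} (n : ℕ) (α β : Fin d → ℝ) : Matrix (Fin n) (Fin n) ℂ :=
  Matrix.of fun i j => toeplitzCoeff α β ((i : ℤ) - (j : ℤ))

/-- Real coordinates on Hermitian matrices: the real diagonal entries, and the complex entries
strictly above the diagonal. -/
abbrev HermitianCoords (n : ℕ) : Type :=
  (Fin n → ℝ) × ({p : Fin n × Fin n // p.1 < p.2} → ℂ)

/-- The Hermitian matrix with given diagonal and strictly upper triangular entries. -/
def hermitianOfCoords (n : ℕ) (c : HermitianCoords n) : Matrix (Fin n) (Fin n) ℂ :=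
  Matrix.of fun i j =>
    if h : i < j then c.2 ⟨(i, j), h⟩
    else if h : j < i then (starRingEnd ℂ) (c.2 ⟨(j, i), h⟩)
    else (c.1 i : ℂ)

theorem hermitianOfCoords_isHermitian (n : ℕ) (c : HermitianCoords n) :
    (hermitianOfCoords n c).IsHermitian := by
  ext i j
  rcases lt_trichotomy i j with h | h | h
  · simp [hermitianOfCoords, Matrix.conjTranspose_apply, h, h.not_gt]
  · subst h
    simp [hermitianOfCoords, Matrix.conjTranspose_apply]
  · simp [hermitianOfCoords, Matrix.conjTranspose_apply, h, h.not_gt]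

/-- The Borel structure on matrices (that of the product of the entries). -/
instance matrixMeasurableSpace (n : ℕ) : MeasurableSpace (Matrix (Fin n) (Fin n) ℂ) :=
  inferInstanceAs (MeasurableSpace (Fin n → Fin n → ℂ))

theorem measurable_hermitianOfCoords (n : ℕ) : Measurable (hermitianOfCoords n) := by
  refine measurable_pi_lambda _ fun i => measurable_pi_lambda _ fun j => ?_
  by_cases h : i < j
  · simp only [hermitianOfCoords, Matrix.of_apply, h, dite_true]
    fun_prop
  · by_cases h' : j < i
    · simp only [hermitianOfCoords, Matrix.of_apply, h, h', dite_true, dite_false]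
      exact Complex.continuous_conj.measurable.comp (by fun_prop)
    · simp only [hermitianOfCoords, Matrix.of_apply, h, h', dite_false]
      fun_prop

/-- Lebesgue measure `dM = ∏_i dM_{ii} ∏_{i<j} dRe(M_{ij}) dIm(M_{ij})` on Hermitian matrices,
as a measure on the space of all matrices. -/
def hermitianLebesgue (n : ℕ) : Measure (Matrix (Fin n) (Fin n) ℂ) :=
  Measure.map (hermitianOfCoords n) volume

/-- The Hermitian matrices all of whose eigenvalues lie in `J`. -/
def hermitianWithSpectrumIn (n : ℕ) (J : Set ℝ) : Set (Matrix (Fin n) (Fin n) ℂ) :=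
  {M | ∃ hM : M.IsHermitian, ∀ i, hM.eigenvalues i ∈ J}

/-- The constant `c_n = 2^{n(n-1)} π^{-n(n+1)/2} ∏_{j=1}^{n-1} j!`. -/
def hermitianConst (n : ℕ) : ℝ :=
  2 ^ (n * (n - 1)) / Real.pi ^ (n * (n + 1) / 2) *
    ∏ j ∈ Finset.Icc 1 (n - 1), (j.factorial : ℝ)

/-- The volume `π^{n(n-1)/2} / (n! ∏_{j=1}^{n-1} j!)` attached to the unitary group: the Weyl
integration constant of Hermitian matrices. -/
def unitaryVolume (n : ℕ) : ℝ :=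
  Real.pi ^ (n * (n - 1) / 2) /
    ((n.factorial : ℝ) * ∏ j ∈ Finset.Icc 1 (n - 1), (j.factorial : ℝ))

/-- The contour integral `∫_{T^n} F(u) du_1 ⋯ du_n`, where `T` is the union of the arcs
`θ ↦ e^{iθ}`, `θ ∈ [α j, β j]`, each traversed in the direction of increasing `θ`: the sum, over
all choices `σ` of an arc for each variable, of the integral over that product of arcs, on which
`du_k = i e^{iθ_k} dθ_k`. -/
def arcContourIntegral {d : ℕ} (n : ℕ) (α β : Fin d → ℝ) (F : (Fin n → ℂ) → ℂ) : ℂ :=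
  ∑ σ : Fin n → Fin d,
    ∫ θ in Set.univ.pi (fun k => Set.Icc (α (σ k)) (β (σ k))),
      F (fun k => Complex.exp (Complex.I * (θ k : ℂ))) *
        ∏ k, (Complex.I * Complex.exp (Complex.I * (θ k : ℂ)))

end

/-!
The circular integral over `I^n` takes the forms of the statement by pointwise identities and
changes of variables, except for the Hermitian matrix integral, which needs Weyl's integration
formula. On the unit circle `|u - v|² = 4 sin² ((s - t) / 2) = -(u - v)² / (u v)` gives the sine
form and the contour form (`circularInteraction_eq_sin`, `contour_integrand`). The substitution
`θ = 2 arctan t` in every variable gives the integral over `J^n`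
(`circularInteraction_two_arctan`, `integral_circularInteraction_tan`). The Toeplitz determinant
is Heine's identity (`circularIntegral_eq_det`): the interaction is the product of a Vandermonde
determinant in `e^{iθ}` and one in `e^{-iθ}`, and after expanding both every term integrates to a
product of Fourier coefficients.

Weyl's formula (`lintegral_hermitianOfCoords`) states that for a unitarily invariant `F ≥ 0` the
integral of `F` over Hermitian matrices is `π^{n(n-1)/2} / ∏_{j<n} j!` times the integral of
`F (diag x) Δ(x)²` over increasing `x`. The proof is an induction on `n` that needs neither
integration over the unitary group nor the evaluation of a Selberg integral. Write a Hermitian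
matrix of size `m + 1` as a border `(a, v)` around a Hermitian block `M`. Integrating `F` over the
border gives a unitarily invariant function of `M` (`borderIntegral`), so by induction `M` may be
taken to be `diag l` with `l` increasing. The characteristic polynomial of the resulting arrow
matrix depends only on `a` and on the weights `w i = |v i|²`, and `v ↦ w` carries Lebesgue measure
on `ℂ^m` to `π^m` times Lebesgue measure on the positive orthant (`lintegral_norm_sq`). For fixed
`l` the corner and weights `(a, w)` correspond bijectively to the eigenvalues `x` interlacing `l`
(`arrowMap_image`, `arrowMap_injOn`), with Jacobian `|Δ(x)| / |Δ(l)|` (`abs_det_arrowJacobian`).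
Exchanging the order of integration leaves the integral of `|Δ(l)|` over the `l` interlaced by
`x`, which is `|Δ(x)| / m!` (`lintegral_vandermondeProd_interlacing`). This completes `Δ(x)²` and
produces the constant of the next size.
-/

noncomputable section

open Polynomial Matrix

/-! ### Bordered matrices and arrow matrices -/

/-- The bordered matrix with corner `a`, first row `r`, first column `c` and remaining block `M`. -/
def border {R : Type*} {n : ℕ} (a : R) (r c : Fin n → R) (M : Matrix (Fin n) (Fin n) R) :
    Matrix (Fin (n + 1)) (Fin (n + 1)) R :=
  Matrix.of (Fin.cons (Fin.cons a r) (fun i => Fin.cons (c i) (M i)))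

section border
variable {R : Type*} {n : ℕ} (a : R) (r c : Fin n → R) (M : Matrix (Fin n) (Fin n) R)

@[simp] theorem border_zero_zero : border a r c M 0 0 = a := rfl
@[simp] theorem border_zero_succ (j : Fin n) : border a r c M 0 j.succ = r j := rfl
@[simp] theorem border_succ_zero (i : Fin n) : border a r c M i.succ 0 = c i := rfl
@[simp] theorem border_succ_succ (i j : Fin n) : border a r c M i.succ j.succ = M i j := rfl

theorem border_mul [CommRing R] (a' : R) (r' c' : Fin n → R) (M' : Matrix (Fin n) (Fin n) R) :
    border a r c M * border a' r' c' M' =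
      border (a * a' + r ⬝ᵥ c') (a • r' + r ᵥ* M') (a' • c + M *ᵥ c')
        (Matrix.vecMulVec c r' + M * M') := by
  ext i j
  refine Fin.cases ?_ (fun i => ?_) i <;> refine Fin.cases ?_ (fun j => ?_) j <;>
    simp [Matrix.mul_apply, Fin.sum_univ_succ, dotProduct, Matrix.vecMul, Matrix.mulVec,
      Matrix.vecMulVec, mul_comm]

theorem star_border [Star R] :
    (border a r c M)ᴴ = border (star a) (star c) (star r) Mᴴ := by
  ext i j
  refine Fin.cases ?_ (fun i => ?_) i <;> refine Fin.cases ?_ (fun j => ?_) j <;> rfl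

theorem border_one [CommRing R] : border (1 : R) 0 0 (1 : Matrix (Fin n) (Fin n) R) = 1 := by
  ext i j
  refine Fin.cases ?_ (fun i => ?_) i <;> refine Fin.cases ?_ (fun j => ?_) j <;>
    simp [Matrix.one_apply, Fin.succ_ne_zero, (Fin.succ_ne_zero _).symm]

theorem det_border_zero [CommRing R] : (border a r 0 M).det = a * M.det := by
  rw [Matrix.det_succ_column_zero, Fin.sum_univ_succ]
  have : (border a r 0 M).submatrix (Fin.succAbove 0) Fin.succ = M := by
    ext i j; simp
  rw [this]
  simp

/-- The determinant of an arrow matrix, by a column operation that clears the first column. -/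
theorem det_border_diagonal [Field R] (d : Fin n → R) (hd : ∀ i, d i ≠ 0) :
    (border a r c (Matrix.diagonal d)).det =
      a * ∏ i, d i - ∑ i, r i * c i * ∏ j ∈ Finset.univ.erase i, d j := by
  have h1 : (border 1 0 (fun i => -(c i / d i)) (1 : Matrix (Fin n) (Fin n) R)).det = 1 := by
    rw [← Matrix.det_transpose]
    have : (border 1 0 (fun i => -(c i / d i)) (1 : Matrix (Fin n) (Fin n) R))ᵀ =
        border 1 (fun i => -(c i / d i)) 0 1 := by
      ext i j
      refine Fin.cases ?_ (fun i => ?_) i <;> refine Fin.cases ?_ (fun j => ?_) j <;>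
        simp [Matrix.one_apply, eq_comm]
    rw [this, det_border_zero]; simp
  have h2 := Matrix.det_mul (border a r c (Matrix.diagonal d))
    (border 1 0 (fun i => -(c i / d i)) (1 : Matrix (Fin n) (Fin n) R))
  have h3 : (1 : R) • c + Matrix.diagonal d *ᵥ (fun i => -(c i / d i)) = 0 := by
    ext i
    simp [Matrix.mulVec_diagonal, mul_div_cancel₀ _ (hd i)]
  rw [h1, mul_one, border_mul, h3, det_border_zero] at h2
  rw [← h2]
  have h4 : Matrix.vecMulVec c 0 + Matrix.diagonal d * (1 : Matrix (Fin n) (Fin n) R)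
      = Matrix.diagonal d := by ext i j; simp [Matrix.vecMulVec]
  rw [h4, Matrix.det_diagonal, mul_one, add_mul, sub_eq_add_neg, dotProduct, Finset.sum_mul,
    ← Finset.sum_neg_distrib]
  congr 1
  refine Finset.sum_congr rfl fun i _ => ?_
  rw [← Finset.mul_prod_erase Finset.univ d (Finset.mem_univ i)]
  have := hd i
  field_simp

end border

theorem border_unitary {n : ℕ} {U : Matrix (Fin n) (Fin n) ℂ}
    (hU : U ∈ Matrix.unitaryGroup (Fin n) ℂ) :
    border 1 0 0 U ∈ Matrix.unitaryGroup (Fin (n + 1)) ℂ := by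
  rw [Matrix.mem_unitaryGroup_iff] at hU ⊢
  rw [Matrix.star_eq_conjTranspose] at hU ⊢
  rw [star_border, border_mul, hU, ← border_one]
  congr 1 <;> simp

/-- Conjugation by the block matrix `1 ⊕ U` conjugates the lower right block by `U` and rotates the
border. -/
theorem border_conj {n : ℕ} (U M : Matrix (Fin n) (Fin n) ℂ) (a : ℂ) (v : Fin n → ℂ) :
    border 1 0 0 U * border a v (star v) M * star (border 1 0 0 U) =
      border a (v ᵥ* star U) (star (v ᵥ* star U)) (U * M * star U) := by
  rw [Matrix.star_eq_conjTranspose, star_border, border_mul, border_mul]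
  congr 1 <;> simp [Matrix.star_vecMul, Matrix.star_eq_conjTranspose]

/-- The polynomial `(X - a) ∏ (X - l i) - ∑ i, w i ∏_{j ≠ i} (X - l j)`, the characteristic
polynomial of an arrow matrix with corner `a`, diagonal `l` and border of squared moduli `w`. -/
def arrowPoly {m : ℕ} (l : Fin m → ℝ) (a : ℝ) (w : Fin m → ℝ) : ℝ[X] :=
  (X - C a) * ∏ i, (X - C (l i)) - ∑ i, C (w i) * ∏ j ∈ Finset.univ.erase i, (X - C (l j))

/-- The determinant formula for arrow matrices applies at every point that is not a diagonal entry,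
and these points suffice to identify the polynomials. -/
theorem charpoly_border_diagonal {m : ℕ} (l : Fin m → ℝ) (a : ℝ) (v : Fin m → ℂ) :
    (border (a : ℂ) v (star v) (Matrix.diagonal fun i => (l i : ℂ))).charpoly =
      (arrowPoly l a (fun i => ‖v i‖ ^ 2)).map (algebraMap ℝ ℂ) := by
  apply Polynomial.eq_of_infinite_eval_eq
  have hfin : (Set.range fun i => (l i : ℂ)).Finite := Set.finite_range _
  refine hfin.infinite_compl.mono fun x hx => ?_
  have hx' : ∀ i, x - l i ≠ 0 := fun i h => hx ⟨i, (sub_eq_zero.1 h).symm⟩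
  rw [Set.mem_ofPred_eq, Matrix.eval_charpoly]
  have : Matrix.scalar (Fin (m + 1)) x - border (a : ℂ) v (star v)
        (Matrix.diagonal fun i => (l i : ℂ)) =
      border (x - a) (-v) (-star v) (Matrix.diagonal fun i => x - l i) := by
    ext i j
    refine Fin.cases ?_ (fun i => ?_) i <;> refine Fin.cases ?_ (fun j => ?_) j <;>
      simp [Matrix.diagonal_apply, Fin.succ_ne_zero, (Fin.succ_ne_zero _).symm]
    split_ifs <;> simp
  rw [this, det_border_diagonal _ _ _ _ hx']
  simp only [arrowPoly, Polynomial.map_sub, Polynomial.map_mul, Polynomial.map_sum,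
    Polynomial.map_prod, Polynomial.map_X, Polynomial.map_C, Polynomial.eval_sub,
    Polynomial.eval_mul, Polynomial.eval_prod, Polynomial.eval_X, Polynomial.eval_C,
    Polynomial.eval_finsetSum, Complex.coe_algebraMap]
  congr 1
  refine Finset.sum_congr rfl fun i _ => ?_
  congr 1
  have := Complex.mul_conj (v i)
  rw [Complex.normSq_eq_norm_sq] at this
  simpa using this

/-! ### Interlacing and the roots of the characteristic polynomial of an arrow matrix -/

/-- The points `x` of `ℝ^(m+1)` that interlace `l` strictly: `x 0 < l 0 < x 1 < l 1 < ⋯ < x m`. -/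
def interlacing {m : ℕ} (l : Fin m → ℝ) : Set (Fin (m + 1) → ℝ) :=
  {x | ∀ i : Fin m, x i.castSucc < l i ∧ l i < x i.succ}

/-- The squared moduli of the border entries that give the arrow matrix with diagonal `l` the
eigenvalues `x`. -/
def arrowWeight {m : ℕ} (l : Fin m → ℝ) (x : Fin (m + 1) → ℝ) (i : Fin m) : ℝ :=
  -(∏ k, (l i - x k)) / ∏ j ∈ Finset.univ.erase i, (l i - l j)

theorem interlacing_strictMono {m : ℕ} {l : Fin m → ℝ} {x : Fin (m + 1) → ℝ}
    (hx : x ∈ interlacing l) : StrictMono x :=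
  Fin.strictMono_iff_lt_succ.2 fun i => (hx i).1.trans (hx i).2

theorem interlacing_strictMono_left {m : ℕ} {l : Fin m → ℝ} {x : Fin (m + 1) → ℝ}
    (hx : x ∈ interlacing l) : StrictMono l := by
  intro i j hij
  refine (hx i).2.trans_le (le_trans ?_ (hx j).1.le)
  exact (interlacing_strictMono hx).monotone (Fin.succ_le_castSucc_iff.2 hij)

theorem coeff_prod_X_sub_C {m : ℕ} (z : Fin (m + 1) → ℝ) :
    (∏ i, (X - C (z i))).coeff m = - ∑ i, z i := by
  have := Polynomial.prod_X_sub_C_coeff_card_pred Finset.univ z (by simp)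
  simpa using this

/-- Monic polynomials of degree `m + 1` with the same sum of roots differ in degree below `m`. -/
theorem prod_X_sub_C_sub_mem_degreeLT {m : ℕ} (x y : Fin (m + 1) → ℝ) (h : ∑ i, x i = ∑ i, y i) :
    ∏ i, (X - C (x i)) - ∏ i, (X - C (y i)) ∈ Polynomial.degreeLT ℝ m := by
  rw [Polynomial.mem_degreeLT, Polynomial.degree_lt_iff_coeff_zero]
  have hdeg : ∀ z : Fin (m + 1) → ℝ, (∏ i, (X - C (z i))).natDegree = m + 1 := fun z => by
    simp [Polynomial.natDegree_prod_of_monic _ _ (fun i _ => monic_X_sub_C (z i))]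
  have hmon : ∀ z : Fin (m + 1) → ℝ, (∏ i, (X - C (z i))).Monic := fun z =>
    monic_prod_of_monic _ _ fun i _ => monic_X_sub_C _
  intro k hk
  rw [coeff_sub]
  rcases hk.eq_or_lt with rfl | hk
  · rw [coeff_prod_X_sub_C, coeff_prod_X_sub_C, h, sub_self]
  rcases (Nat.succ_le_of_lt hk).eq_or_lt with rfl | hk
  · have h1 := (hmon x).coeff_natDegree
    have h2 := (hmon y).coeff_natDegree
    rw [hdeg] at h1 h2
    rw [h1, h2, sub_self]
  · rw [coeff_eq_zero_of_natDegree_lt, coeff_eq_zero_of_natDegree_lt, sub_self] <;>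
      rw [hdeg] <;> exact hk

theorem sum_mul_prod_erase_mem_degreeLT {m : ℕ} (l w : Fin m → ℝ) :
    ∑ i, C (w i) * ∏ j ∈ Finset.univ.erase i, (X - C (l j)) ∈ Polynomial.degreeLT ℝ m := by
  refine Submodule.sum_mem _ fun i _ => ?_
  rw [← Polynomial.smul_eq_C_mul]
  refine Submodule.smul_mem _ _ ?_
  rw [Polynomial.mem_degreeLT, Polynomial.degree_prod]
  simp only [degree_X_sub_C, Finset.sum_const, nsmul_eq_mul, mul_one]
  rw [Finset.card_erase_of_mem (Finset.mem_univ i)]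
  have := i.pos
  simp only [Finset.card_univ, Fintype.card_fin]
  exact_mod_cast Nat.sub_lt this one_pos

theorem cons_prod_X_sub_C {m : ℕ} (l : Fin m → ℝ) (a : ℝ) :
    (X - C a) * ∏ i, (X - C (l i)) = ∏ i, (X - C ((Fin.cons a l : Fin (m + 1) → ℝ) i)) := by
  simp [Fin.prod_univ_succ]

theorem eval_arrowPoly {m : ℕ} (l : Fin m → ℝ) (a : ℝ) (w : Fin m → ℝ) (i : Fin m) :
    (arrowPoly l a w).eval (l i) = - (w i * ∏ j ∈ Finset.univ.erase i, (l i - l j)) := by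
  simp only [arrowPoly, eval_sub, eval_mul, eval_prod, eval_X, eval_C, eval_finsetSum]
  rw [Finset.prod_eq_zero (Finset.mem_univ i) (sub_self _), mul_zero, zero_sub,
    Finset.sum_eq_single i]
  · intro j _ hj
    rw [Finset.prod_eq_zero (Finset.mem_erase.2 ⟨hj.symm, Finset.mem_univ i⟩) (sub_self _),
      mul_zero]
  · simp

theorem prod_erase_sub_ne_zero {m : ℕ} {l : Fin m → ℝ} (hl : Function.Injective l) (i : Fin m) :
    ∏ j ∈ Finset.univ.erase i, (l i - l j) ≠ 0 :=
  Finset.prod_ne_zero_iff.2 fun _ hj => sub_ne_zero.2 (hl.ne (Finset.ne_of_mem_erase hj).symm)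

/-- Both sides agree at the points of `l`, and the choice of the corner brings their difference
below degree `m`. -/
theorem arrowPoly_arrowWeight {m : ℕ} {l : Fin m → ℝ} (hl : Function.Injective l)
    (x : Fin (m + 1) → ℝ) :
    arrowPoly l (∑ k, x k - ∑ i, l i) (arrowWeight l x) = ∏ k, (X - C (x k)) := by
  refine Polynomial.eq_of_degree_sub_lt_of_eval_index_eq Finset.univ hl.injOn ?_ fun i _ => ?_
  · rw [Finset.card_univ, Fintype.card_fin, ← Polynomial.mem_degreeLT, arrowPoly,
      sub_right_comm, cons_prod_X_sub_C]
    refine Submodule.sub_mem _ (prod_X_sub_C_sub_mem_degreeLT _ _ ?_)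
      (sum_mul_prod_erase_mem_degreeLT _ _)
    simp [Fin.sum_univ_succ]
  · rw [eval_arrowPoly, arrowWeight, div_mul_cancel₀ _ (prod_erase_sub_ne_zero hl i)]
    simp [eval_prod]

/-- An arrow polynomial determines its corner and its weights. -/
theorem arrowPoly_eq_prod {m : ℕ} {l : Fin m → ℝ} (hl : Function.Injective l) {a : ℝ}
    {w : Fin m → ℝ} {x : Fin (m + 1) → ℝ} (h : arrowPoly l a w = ∏ k, (X - C (x k))) :
    a = ∑ k, x k - ∑ i, l i ∧ w = arrowWeight l x := by
  constructor
  · have h1 := congrArg (fun p => p.coeff m) h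
    have h2 : (∑ i, C (w i) * ∏ j ∈ Finset.univ.erase i, (X - C (l j))).coeff m = 0 :=
      coeff_eq_zero_of_degree_lt
        (Polynomial.mem_degreeLT.1 (sum_mul_prod_erase_mem_degreeLT l w))
    simp only [arrowPoly, coeff_sub, h2, cons_prod_X_sub_C, coeff_prod_X_sub_C] at h1
    simp only [Fin.sum_univ_succ (Fin.cons a l : Fin (m + 1) → ℝ), Fin.cons_zero,
      Fin.cons_succ] at h1
    linarith
  · ext i
    have h1 := congrArg (fun p => p.eval (l i)) h
    simp only [eval_arrowPoly, eval_prod, eval_sub, eval_X, eval_C] at h1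
    rw [arrowWeight, eq_div_iff (prod_erase_sub_ne_zero hl i), ← h1, neg_neg]

theorem prod_X_sub_C_injOn {m : ℕ} {x y : Fin m → ℝ} (hx : StrictMono x) (hy : StrictMono y)
    (h : ∏ k, (X - C (x k)) = ∏ k, (X - C (y k))) : x = y := by
  refine (StrictMono.range_inj hx hy).1 ?_
  have key : ∀ z : Fin m → ℝ, Set.range z = {t | (∏ k, (X - C (z k))).eval t = 0} := fun z => by
    ext t
    rw [Set.mem_ofPred_eq, eval_prod, Finset.prod_eq_zero_iff]
    simp [sub_eq_zero, eq_comm]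
  rw [key, key, h]

theorem prod_erase_sub_eq_prod_ite {m : ℕ} (l : Fin m → ℝ) (i : Fin m) :
    ∏ j ∈ Finset.univ.erase i, (l i - l j) = ∏ j, if j = i then 1 else (l i - l j) := by
  rw [← Finset.mul_prod_erase Finset.univ _ (Finset.mem_univ i), if_pos rfl, one_mul]
  exact Finset.prod_congr rfl fun j hj => (if_neg (Finset.ne_of_mem_erase hj)).symm

theorem arrowWeight_pos {m : ℕ} {l : Fin m → ℝ} {x : Fin (m + 1) → ℝ}
    (hx : x ∈ interlacing l) (i : Fin m) : 0 < arrowWeight l x i := by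
  have hl := interlacing_strictMono_left hx
  have hxm := interlacing_strictMono hx
  -- the factor of `x i.succ` gives the sign; the others are paired with those of the denominator
  rw [arrowWeight, prod_erase_sub_eq_prod_ite, Fin.prod_univ_succAbove _ i.succ,
    ← neg_mul, mul_div_assoc, ← Finset.prod_div_distrib]
  refine mul_pos (by linarith [(hx i).2]) (Finset.prod_pos fun j _ => ?_)
  rcases lt_trichotomy j i with h | h | h
  · rw [if_neg h.ne, Fin.succAbove_of_castSucc_lt _ _ (Fin.castSucc_lt_succ_iff.2 h.le)]
    exact div_pos (by linarith [(hx j).1, hl h]) (by linarith [hl h])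
  · subst h
    rw [if_pos rfl, Fin.succAbove_of_castSucc_lt _ _ (Fin.castSucc_lt_succ)]
    simpa using (hx j).1
  · rw [if_neg h.ne', Fin.succAbove_of_le_castSucc _ _ (Fin.succ_le_castSucc_iff.2 h)]
    exact div_pos_of_neg_of_neg (by linarith [(hx j).2, hl h]) (by linarith [hl h])


theorem prod_X_sub_C_degree {m : ℕ} (z : Fin m → ℝ) :
    (∏ i, (X - C (z i)) : ℝ[X]).degree = ((m : ℕ) : WithBot ℕ) := by
  simp [Polynomial.degree_prod]

theorem arrowPoly_monic {m : ℕ} (l : Fin m → ℝ) (a : ℝ) (w : Fin m → ℝ) :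
    (arrowPoly l a w).Monic ∧ (arrowPoly l a w).degree = (m + 1 : ℕ) := by
  have h1 := Polynomial.mem_degreeLT.1 (sum_mul_prod_erase_mem_degreeLT l w)
  have h2 := prod_X_sub_C_degree (Fin.cons a l : Fin (m + 1) → ℝ)
  have h3 : (∑ i, C (w i) * ∏ j ∈ Finset.univ.erase i, (X - C (l j))).degree <
      (∏ i, (X - C ((Fin.cons a l : Fin (m + 1) → ℝ) i))).degree := by
    rw [h2]; exact h1.trans (by exact_mod_cast Nat.lt_succ_self m)
  rw [arrowPoly, cons_prod_X_sub_C]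
  exact ⟨(monic_prod_of_monic _ _ fun i _ => monic_X_sub_C _).sub_of_left h3,
    by rw [degree_sub_eq_left_of_degree_lt h3, h2]⟩

theorem neg_one_pow_mul_prod_erase_pos {m : ℕ} {l : Fin m → ℝ} (hl : StrictMono l) (i : Fin m) :
    0 < (-1 : ℝ) ^ (m - 1 - i : ℕ) * ∏ j ∈ Finset.univ.erase i, (l i - l j) := by
  have h2 : (-1 : ℝ) ^ (m - 1 - i : ℕ) = ∏ j, if i < j then (-1 : ℝ) else 1 := by
    rw [Finset.prod_ite]
    simp only [Finset.prod_const, one_pow, mul_one]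
    congr 1
    have : Finset.univ.filter (fun j => i < j) = Finset.Ioi i := by ext; simp
    rw [this, Fin.card_Ioi]
  rw [prod_erase_sub_eq_prod_ite, h2, ← Finset.prod_mul_distrib]
  refine Finset.prod_pos fun j _ => ?_
  rcases lt_trichotomy j i with h | h | h
  · rw [if_neg h.not_gt, if_neg h.ne, one_mul]; linarith [hl h]
  · subst h; simp
  · rw [if_pos h, if_neg h.ne']; linarith [hl h]

/-- For positive weights the arrow polynomial alternates in sign along the points of `l`, and so
it splits over `ℝ` with roots that interlace `l`. -/
theorem exists_interlacing_arrowPoly {m : ℕ} {l : Fin m → ℝ} (hl : StrictMono l) (a : ℝ)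
    {w : Fin m → ℝ} (hw : ∀ i, 0 < w i) :
    ∃ x ∈ interlacing l, arrowPoly l a w = ∏ k, (X - C (x k)) := by
  obtain ⟨hmon, hdeg⟩ := arrowPoly_monic l a w
  set p := arrowPoly l a w with hp
  have hpos : (0 : WithBot ℕ) < p.degree := by rw [hdeg]; exact_mod_cast Nat.succ_pos m
  have htop : Filter.Tendsto (fun t => p.eval t) Filter.atTop Filter.atTop :=
    p.tendsto_atTop_of_leadingCoeff_nonneg hpos (by rw [hmon.leadingCoeff]; exact zero_le_one)
  have hbot : Filter.Tendsto (fun t => (-1) ^ (m + 1) * p.eval (-t)) Filter.atTop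
      Filter.atTop := by
    have hnd : p.natDegree = m + 1 := natDegree_eq_of_degree_eq_some hdeg
    have h1 : (C ((-1 : ℝ) ^ (m + 1)) * p.comp (-X)).degree = (m + 1 : ℕ) := by
      rw [degree_C_mul (by simp), degree_eq_natDegree, natDegree_comp, natDegree_neg,
        natDegree_X, mul_one, hnd]
      intro h
      have := congrArg natDegree h
      rw [natDegree_comp, natDegree_neg, natDegree_X, mul_one, hnd] at this
      simp at this
    have := (C ((-1 : ℝ) ^ (m + 1)) * p.comp (-X)).tendsto_atTop_of_leadingCoeff_nonneg
      (by rw [h1]; exact_mod_cast Nat.succ_pos m) (by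
        rw [leadingCoeff_mul, leadingCoeff_C, leadingCoeff_comp (by simp), hmon.leadingCoeff,
          hnd, leadingCoeff_neg, leadingCoeff_X, one_mul, ← mul_pow]
        simp)
    simpa using this
  obtain ⟨R, hR0, hRp, hRl⟩ := ((Filter.eventually_gt_atTop (0 : ℝ)).and
    ((htop.eventually_gt_atTop 0).and (Filter.eventually_all.2 fun i =>
      Filter.eventually_gt_atTop (l i)))).exists
  obtain ⟨L, hL0, hLp, hLl⟩ := ((Filter.eventually_gt_atTop (0 : ℝ)).and
    ((hbot.eventually_gt_atTop 0).and (Filter.eventually_all.2 fun i =>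
      Filter.eventually_gt_atTop (- l i)))).exists
  -- the points `l`, with a far point added on either side
  set y : Fin (m + 2) → ℝ := Fin.cons (-L) (Fin.snoc l R : Fin (m + 1) → ℝ) with hy
  have hymid : ∀ i : Fin m, y i.castSucc.succ = l i := fun i => by simp [hy]
  have hysign : ∀ j : Fin (m + 2), 0 < (-1 : ℝ) ^ (m + 1 - j : ℕ) * p.eval (y j) := by
    refine Fin.cases ?_ (fun j => ?_)
    · simpa [hy] using hLp
    · refine Fin.lastCases ?_ (fun i => ?_) j
      · simpa [hy] using hRp
      · rw [hymid, hp, eval_arrowPoly]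
        have h := mul_pos (neg_one_pow_mul_prod_erase_pos hl i) (hw i)
        have e : m + 1 - ((i.castSucc.succ : Fin (m + 2)) : ℕ) = (m - 1 - i : ℕ) + 1 := by
          simp; omega
        rw [e, pow_succ]
        linarith
  have hyinc : ∀ k : Fin (m + 1), y k.castSucc < y k.succ := by
    refine Fin.cases ?_ (fun k => ?_)
    · simp only [hy, Fin.castSucc_zero, Fin.cons_zero, Fin.cons_succ]
      refine Fin.lastCases (motive := fun j => -L < (Fin.snoc l R : Fin (m + 1) → ℝ) j)
        ?_ (fun i => ?_) 0
      · simp; linarith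
      · simp only [Fin.snoc_castSucc]; linarith [hLl i]
    · rw [← Fin.succ_castSucc, hymid]
      simp only [hy, Fin.cons_succ]
      have := Fin.lastCases (motive := fun j : Fin (m + 1) => k.castSucc < j →
        l k < (Fin.snoc l R : Fin (m + 1) → ℝ) j)
        (fun _ => by simpa using hRl k) (fun i hi => by simpa using hl (by simpa using hi)) k.succ
      exact this Fin.castSucc_lt_succ
  have hroot : ∀ k : Fin (m + 1), ∃ t, y k.castSucc < t ∧ t < y k.succ ∧ p.eval t = 0 := by
    intro k
    have h1 := hysign k.castSucc
    have h2 := hysign k.succ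
    have e : m + 1 - ((k.castSucc : Fin (m + 2)) : ℕ) =
        (m + 1 - ((k.succ : Fin (m + 2)) : ℕ)) + 1 := by simp; omega
    rw [e, pow_succ] at h1
    set s : ℝ := (-1) ^ (m + 1 - ((k.succ : Fin (m + 2)) : ℕ)) with hs
    have hcont : ContinuousOn (fun t => s * p.eval t) (Set.Icc (y k.castSucc) (y k.succ)) :=
      (continuous_const.mul p.continuous).continuousOn
    obtain ⟨t, ⟨ht1, ht2⟩, ht⟩ := intermediate_value_Ioo (hyinc k).le hcont
      (show (0 : ℝ) ∈ _ from ⟨by linarith, h2⟩)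
    exact ⟨t, ht1, ht2, (mul_eq_zero.1 ht).resolve_left (by simp [hs])⟩
  choose x hx1 hx2 hx0 using hroot
  have hxi : x ∈ interlacing l := fun i => by
    refine ⟨?_, ?_⟩
    · rw [← hymid i]; exact hx2 _
    · rw [← hymid i, Fin.succ_castSucc]; exact hx1 _
  refine ⟨x, hxi, Polynomial.eq_of_degree_sub_lt_of_eval_index_eq Finset.univ
    (interlacing_strictMono hxi).injective.injOn ?_ fun k _ => ?_⟩
  · have hd2 := prod_X_sub_C_degree x
    rw [Finset.card_univ, Fintype.card_fin, ← hdeg]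
    refine degree_sub_lt_left (by rw [hdeg, hd2]) hmon.ne_zero ?_
    rw [hmon.leadingCoeff, (monic_prod_of_monic _ _ fun i _ => monic_X_sub_C _).leadingCoeff]
  · rw [hx0, eval_prod, Finset.prod_eq_zero (Finset.mem_univ k)]
    simp

/-! ### The change of variables from weights to eigenvalues -/

theorem abs_vandermondeProd {m : ℕ} (x : Fin m → ℝ) :
    |vandermondeProd x| = |(Matrix.vandermonde x).det| := by
  rw [Matrix.det_vandermonde, vandermondeProd, Finset.abs_prod, Finset.abs_prod]
  refine Finset.prod_congr rfl fun i _ => ?_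
  rw [Finset.abs_prod, Finset.abs_prod]
  exact Finset.prod_congr rfl fun j _ => abs_sub_comm _ _

theorem vandermondeProd_ne_zero {m : ℕ} {x : Fin m → ℝ} (hx : Function.Injective x) :
    vandermondeProd x ≠ 0 := by
  rw [← abs_ne_zero, abs_vandermondeProd, abs_ne_zero]
  exact Matrix.det_vandermonde_ne_zero_iff.2 hx

theorem abs_prod_prod_erase_sub {m : ℕ} (x : Fin m → ℝ) :
    |∏ i, ∏ j ∈ Finset.univ.erase i, (x i - x j)| = |vandermondeProd x| ^ 2 := by
  have h := Finset.prod_prod_Ioi_mul_eq_prod_prod_off_diag (fun i j : Fin m => |x j - x i|)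
  have h2 : ∀ i : Fin m, ({i}ᶜ : Finset (Fin m)) = Finset.univ.erase i := fun i => by
    ext; simp
  simp only [h2] at h
  simp only [Finset.abs_prod]
  rw [← h, vandermondeProd]
  simp only [Finset.abs_prod, ← Finset.prod_pow]
  refine Finset.prod_congr rfl fun i _ => Finset.prod_congr rfl fun j _ => ?_
  rw [abs_sub_comm (x j), sq]

/-- The corner and the weights of the arrow matrix with diagonal `l` and eigenvalues `x`. -/
def arrowMap {m : ℕ} (l : Fin m → ℝ) (x : Fin (m + 1) → ℝ) : Fin (m + 1) → ℝ :=
  Fin.cons (∑ k, x k - ∑ i, l i) (arrowWeight l x)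

/-- The Jacobian matrix of `arrowMap l`. -/
def arrowJacobian {m : ℕ} (l : Fin m → ℝ) (x : Fin (m + 1) → ℝ) :
    Matrix (Fin (m + 1)) (Fin (m + 1)) ℝ :=
  Matrix.of (Fin.cons (fun _ => 1) fun i k =>
    (∏ j ∈ Finset.univ.erase i, (l i - l j))⁻¹ * ∏ j ∈ Finset.univ.erase k, (l i - x j))

theorem hasFDerivAt_arrowMap {m : ℕ} (l : Fin m → ℝ) (x : Fin (m + 1) → ℝ) :
    HasFDerivAt (arrowMap l) (Matrix.toLin' (arrowJacobian l x)).toContinuousLinearMap x := by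
  rw [hasFDerivAt_pi']
  refine Fin.cases ?_ fun i => ?_
  · have h : HasFDerivAt (fun y : Fin (m + 1) → ℝ => ∑ k, y k - ∑ i, l i)
        (∑ k, ContinuousLinearMap.proj (R := ℝ) (φ := fun _ : Fin (m + 1) => ℝ) k) x :=
      (HasFDerivAt.fun_sum fun k _ => hasFDerivAt_apply k x).sub_const _
    refine h.congr_fderiv ?_
    ext v
    simp [arrowJacobian, Matrix.mulVec, dotProduct]
  · have h1 := HasFDerivAt.finsetProd (u := Finset.univ) (x := x)
      (g := fun (k : Fin (m + 1)) (y : Fin (m + 1) → ℝ) => l i - y k)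
      (fun k _ => (hasFDerivAt_apply (𝕜 := ℝ) k x).const_sub (l i))
    have h2 := (h1.neg).mul_const (∏ j ∈ Finset.univ.erase i, (l i - l j))⁻¹
    refine (h2.congr_fderiv ?_).congr_of_eventuallyEq (Filter.Eventually.of_forall fun y => ?_)
    · refine ContinuousLinearMap.ext fun v => ?_
      simp [arrowJacobian, Matrix.mulVec, dotProduct, Finset.mul_sum, mul_assoc]
    · simp [arrowMap, arrowWeight, div_eq_mul_inv]

/-- The Jacobian is a projective Vandermonde matrix (with a node at infinity) times the matrix `B`
of coefficients of the polynomials `∏_{j ≠ k} (X - x j)`, up to the scaling of the rows; the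
determinant of `B` is read off from its product with the Vandermonde matrix of `x`. -/
theorem abs_det_arrowJacobian {m : ℕ} {l : Fin m → ℝ} {x : Fin (m + 1) → ℝ}
    (hl : Function.Injective l) (hx : Function.Injective x) :
    |(arrowJacobian l x).det| = |vandermondeProd x| / |vandermondeProd l| := by
  set P : Fin (m + 1) → ℝ[X] := fun k => ∏ j ∈ Finset.univ.erase k, (X - C (x j)) with hP
  have hPmon : ∀ k, (P k).Monic := fun k => monic_prod_of_monic _ _ fun i _ => monic_X_sub_C _
  have hPdeg : ∀ k, (P k).natDegree = m := fun k => by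
    rw [hP, Polynomial.natDegree_prod_of_monic _ _ (fun i _ => monic_X_sub_C (x i))]
    simp [Finset.card_erase_of_mem]
  set B : Matrix (Fin (m + 1)) (Fin (m + 1)) ℝ := Matrix.of fun j k => (P k).coeff j with hB
  have heval : ∀ (t : ℝ) k, ∑ j : Fin (m + 1), t ^ (j : ℕ) * B j k = (P k).eval t := by
    intro t k
    rw [Polynomial.eval_eq_sum_range, hPdeg, ← Fin.sum_univ_eq_sum_range
      (fun j => (P k).coeff j * t ^ j)]
    exact Finset.sum_congr rfl fun j _ => mul_comm _ _
  have h1 : Matrix.vandermonde x * B = Matrix.diagonal fun k => (P k).eval (x k) := by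
    ext i k
    rw [Matrix.mul_apply]
    simp only [Matrix.vandermonde_apply]
    rw [heval, Matrix.diagonal_apply]
    split_ifs with h
    · rw [h]
    · rw [hP]
      simp only [eval_prod]
      exact Finset.prod_eq_zero (Finset.mem_erase.2 ⟨h, Finset.mem_univ i⟩) (by simp)
  have hB2 : |B.det| = |vandermondeProd x| := by
    have h := congrArg (fun A => |Matrix.det A|) h1
    simp only [Matrix.det_mul, Matrix.det_diagonal, abs_mul, hP, eval_prod, eval_sub, eval_X,
      eval_C] at h
    rw [abs_prod_prod_erase_sub, ← abs_vandermondeProd, sq] at h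
    exact mul_left_cancel₀ (abs_ne_zero.2 (vandermondeProd_ne_zero hx)) h
  have h2 : arrowJacobian l x =
      Matrix.diagonal (Fin.cons 1 fun i => (∏ j ∈ Finset.univ.erase i, (l i - l j))⁻¹ :
        Fin (m + 1) → ℝ) *
      (Matrix.projVandermonde (Fin.cons 1 l) (Fin.cons 0 1 : Fin (m + 1) → ℝ) * B) := by
    ext i k
    rw [Matrix.diagonal_mul, Matrix.mul_apply]
    simp only [Matrix.projVandermonde_apply]
    refine Fin.cases ?_ (fun i => ?_) i
    · rw [Finset.sum_eq_single (Fin.last m)]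
      · have := (hPmon k).coeff_natDegree
        rw [hPdeg] at this
        simp [arrowJacobian, hB, this]
      · intro j _ hj
        -- the node at infinity picks out the leading coefficient
        have : m - (j : ℕ) ≠ 0 := by
          have := Fin.val_lt_last hj
          omega
        simp [Fin.val_rev, this]
      · simp
    · have := heval (l i) k
      simp only [hP, eval_prod, eval_sub, eval_X, eval_C] at this
      simp [arrowJacobian, this]
  have h3 : |(Matrix.projVandermonde (Fin.cons 1 l) (Fin.cons 0 1 : Fin (m + 1) → ℝ)).det| =
      |vandermondeProd l| := by
    rw [abs_vandermondeProd, Matrix.det_vandermonde, Matrix.det_projVandermonde,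
      Fin.prod_univ_succ, abs_mul]
    simp [Fin.prod_Ioi_succ, Finset.abs_prod]
  have h4 : |∏ i, (∏ j ∈ Finset.univ.erase i, (l i - l j))⁻¹| = (|vandermondeProd l| ^ 2)⁻¹ := by
    rw [Finset.prod_inv_distrib, abs_inv, abs_prod_prod_erase_sub]
  rw [h2, Matrix.det_mul, Matrix.det_mul, Matrix.det_diagonal, abs_mul, abs_mul, h3, hB2,
    Fin.prod_univ_succ]
  simp only [Fin.cons_zero, Fin.cons_succ, one_mul]
  rw [h4]
  have := abs_ne_zero.2 (vandermondeProd_ne_zero hl)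
  field_simp

theorem measurableSet_interlacing {m : ℕ} (l : Fin m → ℝ) : MeasurableSet (interlacing l) := by
  simp only [interlacing, Set.ofPred_forall, Set.ofPred_and]
  exact MeasurableSet.iInter fun i =>
    (measurableSet_lt (measurable_pi_apply _) measurable_const).inter
      (measurableSet_lt measurable_const (measurable_pi_apply _))

theorem arrowMap_injOn {m : ℕ} {l : Fin m → ℝ} (hl : StrictMono l) :
    Set.InjOn (arrowMap l) (interlacing l) := by
  intro x hx y hy h
  have h0 := congrFun h 0
  have h1 : arrowWeight l x = arrowWeight l y := funext fun i => congrFun h i.succ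
  simp only [arrowMap, Fin.cons_zero] at h0
  refine prod_X_sub_C_injOn (interlacing_strictMono hx) (interlacing_strictMono hy) ?_
  rw [← arrowPoly_arrowWeight hl.injective, ← arrowPoly_arrowWeight hl.injective, h0, h1]

/-- Positivity of the weights characterizes interlacing. -/
theorem arrowMap_image {m : ℕ} {l : Fin m → ℝ} (hl : StrictMono l) :
    arrowMap l '' interlacing l = {z | ∀ i : Fin m, 0 < z i.succ} := by
  ext z
  constructor
  · rintro ⟨x, hx, rfl⟩ i
    exact arrowWeight_pos hx i
  · intro hz
    obtain ⟨x, hx, h⟩ := exists_interlacing_arrowPoly hl (z 0) (w := fun i => z i.succ) hz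
    obtain ⟨h1, h2⟩ := arrowPoly_eq_prod hl.injective h
    refine ⟨x, hx, funext (Fin.cases ?_ fun i => ?_)⟩
    · exact h1.symm
    · exact (congrFun h2 i).symm

theorem lintegral_arrowMap {m : ℕ} {l : Fin m → ℝ} (hl : StrictMono l)
    (g : (Fin (m + 1) → ℝ) → ENNReal) :
    ∫⁻ z in {z : Fin (m + 1) → ℝ | ∀ i : Fin m, 0 < z i.succ}, g z =
      ∫⁻ x in interlacing l,
        ENNReal.ofReal (|vandermondeProd x| / |vandermondeProd l|) * g (arrowMap l x) := by
  rw [← arrowMap_image hl, lintegral_image_eq_lintegral_abs_det_fderiv_mul volume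
    (measurableSet_interlacing l)
    (fun x _ => (hasFDerivAt_arrowMap l x).hasFDerivWithinAt) (arrowMap_injOn hl)]
  refine setLIntegral_congr_fun (measurableSet_interlacing l) fun x hx => ?_
  rw [← abs_det_arrowJacobian hl.injective (interlacing_strictMono hx).injective]
  congr 3
  rw [ContinuousLinearMap.det, LinearMap.coe_toContinuousLinearMap, LinearMap.det_toLin']

/-! ### The integral of the Vandermonde product over interlacing points -/

/-- Subtracting from each row of the Vandermonde matrix the preceding one leaves a first column with
a single nonzero entry. -/
theorem det_pow_succ_sub_pow_succ {m : ℕ} (x : Fin (m + 1) → ℝ) :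
    (Matrix.of fun i j : Fin m => x i.succ ^ (j + 1 : ℕ) - x i.castSucc ^ (j + 1 : ℕ)).det =
      (Matrix.vandermonde x).det := by
  set B : Matrix (Fin (m + 1)) (Fin (m + 1)) ℝ :=
    Matrix.of (Fin.cons (fun j => x 0 ^ (j : ℕ)) fun i j =>
      x i.succ ^ (j : ℕ) - x i.castSucc ^ (j : ℕ)) with hB
  have h : (Matrix.vandermonde x).det = B.det := by
    refine Matrix.det_eq_of_forall_row_eq_smul_add_pred (fun _ => 1) (fun j => ?_) fun i j => ?_
    · simp [hB, Matrix.vandermonde_apply]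
    · simp [hB, Matrix.vandermonde_apply]
  rw [h, Matrix.det_succ_column_zero, Fin.sum_univ_succ]
  simp only [hB, Matrix.of_apply, Fin.cons_zero, Fin.cons_succ, Fin.val_zero, pow_zero, sub_self,
    mul_zero, zero_mul, Finset.sum_const_zero, add_zero, one_mul]
  congr 1

/-- Integrating the determinant row by row turns the monomials `t^j` into the differences of
`t^(j+1) / (j+1)` at the endpoints. -/
theorem integral_det_vandermonde_pi_Ioo {m : ℕ} {x : Fin (m + 1) → ℝ} (hx : StrictMono x) :
    ∫ l in Set.univ.pi fun i : Fin m => Set.Ioo (x i.castSucc) (x i.succ),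
      (Matrix.vandermonde l).det = (Matrix.vandermonde x).det / (m.factorial : ℝ) := by
  have hint : ∀ σ : Equiv.Perm (Fin m), Integrable
      (fun l : Fin m → ℝ => ((Equiv.Perm.sign σ : ℤ) : ℝ) * ∏ i, l (σ i) ^ (i : ℕ))
      (volume.restrict (Set.univ.pi fun i : Fin m => Set.Ioo (x i.castSucc) (x i.succ))) := by
    intro σ
    have hc : Continuous
        (fun l : Fin m → ℝ => ((Equiv.Perm.sign σ : ℤ) : ℝ) * ∏ i, l (σ i) ^ (i : ℕ)) := by
      fun_prop
    have := hc.continuousOn.integrableOn_compact (μ := volume)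
      (isCompact_univ_pi fun i : Fin m => isCompact_Icc (a := x i.castSucc) (b := x i.succ))
    exact this.mono_set (Set.pi_mono fun i _ => Set.Ioo_subset_Icc_self)
  have hone : ∀ (i : Fin m) (k : ℕ), ∫ t in Set.Ioo (x i.castSucc) (x i.succ), t ^ k =
      (k + 1 : ℝ)⁻¹ * (x i.succ ^ (k + 1) - x i.castSucc ^ (k + 1)) := by
    intro i k
    rw [← integral_Ioc_eq_integral_Ioo, ← intervalIntegral.integral_of_le
      (hx Fin.castSucc_lt_succ).le, integral_pow]
    field_simp
  have hexp : ∀ l : Fin m → ℝ, (Matrix.vandermonde l).det =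
      ∑ σ : Equiv.Perm (Fin m), ((Equiv.Perm.sign σ : ℤ) : ℝ) * ∏ i, l (σ i) ^ (i : ℕ) :=
    fun l => by simp only [Matrix.det_apply', Matrix.vandermonde_apply]
  simp only [hexp]
  rw [integral_finsetSum _ fun σ _ => hint σ]
  have hterm : ∀ σ : Equiv.Perm (Fin m),
      ∫ l in Set.univ.pi fun i : Fin m => Set.Ioo (x i.castSucc) (x i.succ),
        ((Equiv.Perm.sign σ : ℤ) : ℝ) * ∏ i, l (σ i) ^ (i : ℕ) =
      ((Equiv.Perm.sign σ : ℤ) : ℝ) * ∏ i : Fin m, (((i : ℕ) + 1 : ℝ)⁻¹ *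
        (x (σ i).succ ^ ((i : ℕ) + 1) - x (σ i).castSucc ^ ((i : ℕ) + 1))) := by
    intro σ
    rw [integral_const_mul, volume_pi, Measure.restrict_pi_pi]
    have : ∀ l : Fin m → ℝ, ∏ i, l (σ i) ^ (i : ℕ) = ∏ i, l i ^ (σ.symm i : ℕ) := fun l => by
      rw [← Equiv.prod_comp σ fun i => l i ^ (σ.symm i : ℕ)]; simp
    simp only [this]
    rw [integral_fintype_prod_eq_prod (fun (i : Fin m) (t : ℝ) => t ^ (σ.symm i : ℕ))]
    simp only [hone]
    rw [← Equiv.prod_comp σ]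
    simp
  simp only [hterm]
  have hdet := Matrix.det_mul_row (fun j : Fin m => ((j : ℕ) + 1 : ℝ)⁻¹)
    (Matrix.of fun i j : Fin m => x i.succ ^ (j + 1 : ℕ) - x i.castSucc ^ (j + 1 : ℕ))
  rw [det_pow_succ_sub_pow_succ, Matrix.det_apply'] at hdet
  simp only [Matrix.of_apply] at hdet
  rw [hdet, Finset.prod_inv_distrib, div_eq_inv_mul]
  congr 2
  rw [Fin.prod_univ_eq_prod_range (fun j => ((j : ℕ) + 1 : ℝ)) m,
    ← Finset.prod_range_add_one_eq_factorial]
  push_cast; rfl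

theorem lintegral_vandermondeProd_interlacing {m : ℕ} {x : Fin (m + 1) → ℝ} (hx : StrictMono x) :
    ∫⁻ l in {l : Fin m → ℝ | x ∈ interlacing l}, ENNReal.ofReal |vandermondeProd l| =
      ENNReal.ofReal (|vandermondeProd x| / (m.factorial : ℝ)) := by
  have hset : {l : Fin m → ℝ | x ∈ interlacing l} =
      Set.univ.pi fun i : Fin m => Set.Ioo (x i.castSucc) (x i.succ) := by
    ext l; simp [interlacing]
  have hmeas : MeasurableSet (Set.univ.pi fun i : Fin m => Set.Ioo (x i.castSucc) (x i.succ)) :=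
    MeasurableSet.univ_pi fun i => measurableSet_Ioo
  have hpos : ∀ {k : ℕ} {y : Fin k → ℝ}, StrictMono y → 0 ≤ (Matrix.vandermonde y).det := by
    intro k y hy
    rw [Matrix.det_vandermonde]
    exact Finset.prod_nonneg fun i _ => Finset.prod_nonneg fun j hj =>
      sub_nonneg.2 (hy (Finset.mem_Ioi.1 hj)).le
  rw [abs_vandermondeProd, abs_of_nonneg (hpos hx), ← integral_det_vandermonde_pi_Ioo hx, hset,
    ofReal_integral_eq_lintegral_ofReal]
  · refine setLIntegral_congr_fun hmeas fun l hl => ?_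
    rw [← hset] at hl
    simp only [abs_vandermondeProd, abs_of_nonneg (hpos (interlacing_strictMono_left hl))]
  · have hc : Continuous (fun l : Fin m → ℝ => (Matrix.vandermonde l).det) := by
      refine Continuous.matrix_det ?_
      exact continuous_matrix fun i j => by simp only [Matrix.vandermonde_apply]; fun_prop
    have := hc.continuousOn.integrableOn_compact (μ := volume)
      (isCompact_univ_pi fun i : Fin m => isCompact_Icc (a := x i.castSucc) (b := x i.succ))
    exact this.mono_set (Set.pi_mono fun i _ => Set.Ioo_subset_Icc_self)
  · filter_upwards [ae_restrict_mem hmeas] with l hl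
    rw [← hset] at hl
    exact hpos (interlacing_strictMono_left hl)

/-! ### Lebesgue measure on `ℂ^n`: unitary invariance and squared moduli -/

theorem measurePreserving_vecMul_unitary {n : ℕ} {U : Matrix (Fin n) (Fin n) ℂ}
    (hU : U ∈ Matrix.unitaryGroup (Fin n) ℂ) :
    MeasurePreserving (fun v : Fin n → ℂ => v ᵥ* U) volume volume := by
  have hdet : LinearMap.det ((Matrix.toLin' Uᵀ).restrictScalars ℝ) = 1 := by
    rw [LinearMap.det_restrictScalars, LinearMap.det_toLin', Matrix.det_transpose,
      Algebra.norm_complex_apply]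
    have h := (Unitary.mem_iff_self_mul_star).1 (Matrix.det_of_mem_unitary hU)
    rw [Complex.star_def, Complex.mul_conj] at h
    exact_mod_cast h
  have hfun : (fun v : Fin n → ℂ => v ᵥ* U) = ((Matrix.toLin' Uᵀ).restrictScalars ℝ) := by
    ext v i
    simp [Matrix.mulVec_transpose]
  refine ⟨?_, ?_⟩
  · rw [hfun]
    exact (LinearMap.continuous_of_finiteDimensional _).measurable
  · rw [hfun, Measure.map_linearMap_addHaar_eq_smul_addHaar volume
      (by rw [hdet]; exact one_ne_zero),
      hdet]
    simp

/-- In polar coordinates the squared modulus is distributed on `ℂ` as `π` times Lebesgue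
measure on the positive half-line. -/
theorem map_norm_sq_volume :
    Measure.map (fun z : ℂ => ‖z‖ ^ 2) volume =
      ENNReal.ofReal Real.pi • (volume : Measure ℝ).restrict (Set.Ioi 0) := by
  have hmeas : Measurable (fun z : ℂ => ‖z‖ ^ 2) := by fun_prop
  have hIic : ∀ b : ℝ, volume ((fun z : ℂ => ‖z‖ ^ 2) ⁻¹' Set.Iic b) =
      ENNReal.ofReal (Real.pi * max b 0) := by
    intro b
    rcases lt_or_ge b 0 with hb | hb
    · have : (fun z : ℂ => ‖z‖ ^ 2) ⁻¹' Set.Iic b = ∅ := by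
        ext z
        simp only [Set.mem_preimage, Set.mem_Iic, Set.mem_empty_iff_false, iff_false, not_le]
        exact hb.trans_le (sq_nonneg _)
      rw [this, max_eq_right hb.le]; simp
    · have : (fun z : ℂ => ‖z‖ ^ 2) ⁻¹' Set.Iic b = Metric.closedBall 0 (Real.sqrt b) := by
        ext z
        simp [Real.le_sqrt (norm_nonneg z) hb]
      rw [this, Complex.volume_closedBall, max_eq_left hb,
        ← ENNReal.ofReal_pow (Real.sqrt_nonneg b),
        Real.sq_sqrt hb, mul_comm, ENNReal.ofReal_mul Real.pi_pos.le]
      congr 1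
      rw [← NNReal.coe_real_pi, ENNReal.ofReal_coe_nnreal]
  have hIoc : ∀ a b : ℝ, a < b → Measure.map (fun z : ℂ => ‖z‖ ^ 2) volume (Set.Ioc a b) =
      ENNReal.ofReal (Real.pi * max b 0 - Real.pi * max a 0) := by
    intro a b hab
    have : Set.Ioc a b = Set.Iic b \ Set.Iic a := by ext; simp [and_comm]
    rw [Measure.map_apply hmeas measurableSet_Ioc, this, Set.preimage_sdiff,
      measure_sdiff (Set.preimage_mono (Set.Iic_subset_Iic.2 hab.le))
        (hmeas measurableSet_Iic).nullMeasurableSet (by rw [hIic]; exact ENNReal.ofReal_ne_top),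
      hIic, hIic, ENNReal.ofReal_sub]
    have := Real.pi_pos
    positivity
  refine Measure.ext_of_Ioc' _ _ (fun a b hab => ?_) fun a b hab => ?_
  · rw [hIoc a b hab]; exact ENNReal.ofReal_ne_top
  · rw [hIoc a b hab, Measure.smul_apply, Measure.restrict_apply measurableSet_Ioc]
    have : Set.Ioc a b ∩ Set.Ioi 0 = Set.Ioc (max a 0) b := by
      ext; simp
    rw [this, Real.volume_Ioc, smul_eq_mul, ← ENNReal.ofReal_mul Real.pi_pos.le, ← mul_sub]
    rcases le_total b 0 with hb | hb
    · rw [max_eq_right hb, ENNReal.ofReal_of_nonpos, ENNReal.ofReal_of_nonpos]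
      · exact mul_nonpos_of_nonneg_of_nonpos Real.pi_pos.le (by linarith [le_max_right a 0])
      · exact mul_nonpos_of_nonneg_of_nonpos Real.pi_pos.le (by linarith [le_max_right a 0])
    · rw [max_eq_left hb]

theorem lintegral_norm_sq {m : ℕ} {g : (Fin m → ℝ) → ENNReal} (hg : Measurable g) :
    ∫⁻ v : Fin m → ℂ, g (fun i => ‖v i‖ ^ 2) =
      ENNReal.ofReal Real.pi ^ m * ∫⁻ w in Set.univ.pi fun _ => Set.Ioi 0, g w := by
  have h1 : Measure.map (fun (v : Fin m → ℂ) i => ‖v i‖ ^ 2) volume =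
      ENNReal.ofReal Real.pi ^ m •
        (volume : Measure (Fin m → ℝ)).restrict (Set.univ.pi fun _ => Set.Ioi 0) := by
    have hf : ∀ _ : Fin m, AEMeasurable (fun z : ℂ => ‖z‖ ^ 2) volume := fun _ => by fun_prop
    have hsf : SigmaFinite
        (ENNReal.ofReal Real.pi • (volume : Measure ℝ).restrict (Set.Ioi 0)) :=
      inferInstanceAs (SigmaFinite (Real.toNNReal Real.pi •
        (volume : Measure ℝ).restrict (Set.Ioi 0)))
    rw [volume_pi, Measure.pi_map_pi (hμ := fun _ => by rw [map_norm_sq_volume]; exact hsf) hf,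
      map_norm_sq_volume]
    refine Measure.pi_eq fun s hs => ?_
    rw [volume_pi, Measure.restrict_pi_pi]
    simp [Measure.pi_pi, Finset.prod_mul_distrib]
  have h2 : Measurable (fun (v : Fin m → ℂ) i => ‖v i‖ ^ 2) := by fun_prop
  rw [← lintegral_map (f := g) hg h2, h1, lintegral_smul_measure, smul_eq_mul]

/-! ### Hermitian coordinates of a bordered matrix -/

/-- The index pairs above the diagonal of a matrix of size `n + 1`: those in the first row, and
those of the lower right block. -/
def upperPairsEquiv (n : ℕ) :
    Fin n ⊕ {p : Fin n × Fin n // p.1 < p.2} ≃ {p : Fin (n + 1) × Fin (n + 1) // p.1 < p.2} :=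
  Equiv.ofBijective
    (Sum.elim (fun j => ⟨(0, j.succ), Fin.succ_pos j⟩)
      fun p => ⟨(p.1.1.succ, p.1.2.succ), Fin.succ_lt_succ_iff.2 p.2⟩) (by
    constructor
    · rintro (i | ⟨⟨i, i'⟩, hi⟩) (j | ⟨⟨j, j'⟩, hj⟩) h
      · simpa using h
      · simp [(Fin.succ_ne_zero _).symm] at h
      · simp at h
      · simpa using h
    · rintro ⟨⟨i, j⟩, h⟩
      obtain ⟨j, rfl⟩ := Fin.exists_succ_eq.2 (Fin.pos_of_ne_zero (a := j)
        (fun h0 => by subst h0; exact absurd h (Fin.not_lt_zero _))).ne'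
      rcases Fin.eq_zero_or_eq_succ i with rfl | ⟨i, rfl⟩
      · exact ⟨Sum.inl j, rfl⟩
      · exact ⟨Sum.inr ⟨(i, j), Fin.succ_lt_succ_iff.1 h⟩, rfl⟩)

/-- The coordinates of a Hermitian matrix of size `n + 1` are, up to a measure-preserving
rearrangement, its corner, its first row, and the coordinates of its lower right block. -/
theorem exists_measurePreserving_border (n : ℕ) :
    ∃ T : (ℝ × (Fin n → ℝ)) × ((Fin n → ℂ) × ({p : Fin n × Fin n // p.1 < p.2} → ℂ)) →
        HermitianCoords (n + 1), MeasurePreserving T volume volume ∧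
      ∀ a x v y, hermitianOfCoords (n + 1) (T ((a, x), (v, y))) =
        border (a : ℂ) v (star v) (hermitianOfCoords n (x, y)) := by
  set e1 := (MeasurableEquiv.piFinSuccAbove (fun _ : Fin (n + 1) => ℝ) 0).symm with he1
  have h1 : MeasurePreserving e1 volume volume :=
    (volume_preserving_piFinSuccAbove (fun _ : Fin (n + 1) => ℝ) 0).symm
  set e2 := (MeasurableEquiv.sumPiEquivProdPi
    (fun _ : Fin n ⊕ {p : Fin n × Fin n // p.1 < p.2} => ℂ)).symm with he2
  have h2 : MeasurePreserving e2 volume volume :=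
    volume_measurePreserving_sumPiEquivProdPi_symm _
  set e3 := MeasurableEquiv.piCongrLeft
    (fun _ : {p : Fin (n + 1) × Fin (n + 1) // p.1 < p.2} => ℂ) (upperPairsEquiv n) with he3
  have h3 : MeasurePreserving e3 volume volume := volume_measurePreserving_piCongrLeft _ _
  refine ⟨Prod.map e1 (e3 ∘ e2), h1.prod (h3.comp h2), fun a x v y => ?_⟩
  have ha0 : e1 (a, x) 0 = a := by simp [he1, MeasurableEquiv.piFinSuccAbove]
  have has : ∀ i : Fin n, e1 (a, x) i.succ = x i := fun i => by
    simp [he1, MeasurableEquiv.piFinSuccAbove]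
  have hv : ∀ (j : Fin n) h, e3 (e2 (v, y)) ⟨(0, j.succ), h⟩ = v j := fun j h =>
    MeasurableEquiv.piCongrLeft_apply_apply (upperPairsEquiv n)
      (β := fun _ => ℂ) (e2 (v, y)) (Sum.inl j)
  have hy : ∀ (i j : Fin n) h h', e3 (e2 (v, y)) ⟨(i.succ, j.succ), h⟩ = y ⟨(i, j), h'⟩ :=
    fun i j h h' => MeasurableEquiv.piCongrLeft_apply_apply (upperPairsEquiv n)
      (β := fun _ => ℂ) (e2 (v, y)) (Sum.inr ⟨(i, j), h'⟩)
  ext i j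
  refine Fin.cases ?_ (fun i => ?_) i <;> refine Fin.cases ?_ (fun j => ?_) j
  · simp [hermitianOfCoords, ha0]
  · simp [hermitianOfCoords, hv]
  · simp [hermitianOfCoords, hv]
  · simp only [hermitianOfCoords, Matrix.of_apply, border_succ_succ, Prod.map_apply,
      Function.comp_apply, Fin.succ_lt_succ_iff]
    split_ifs with h h'
    · exact hy _ _ _ _
    · rw [hy]
    · rw [has]

instance matrixBorelSpace (n : ℕ) : BorelSpace (Matrix (Fin n) (Fin n) ℂ) :=
  inferInstanceAs (BorelSpace (Fin n → Fin n → ℂ))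

theorem measurable_border (n : ℕ) :
    Measurable fun q : (Matrix (Fin n) (Fin n) ℂ × (Fin n → ℂ)) × ℝ =>
      border (q.2 : ℂ) q.1.2 (star q.1.2) q.1.1 := by
  refine measurable_pi_lambda _ fun i => measurable_pi_lambda _ fun j => ?_
  have hM : ∀ i j : Fin n, Measurable fun q : (Matrix (Fin n) (Fin n) ℂ × (Fin n → ℂ)) × ℝ =>
      q.1.1 i j := fun i j =>
    (measurable_pi_apply j).comp ((measurable_pi_apply i).comp (measurable_fst.comp measurable_fst))
  have hv : ∀ j : Fin n, Measurable fun q : (Matrix (Fin n) (Fin n) ℂ × (Fin n → ℂ)) × ℝ =>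
      q.1.2 j := fun j => (measurable_pi_apply j).comp (measurable_snd.comp measurable_fst)
  refine Fin.cases ?_ (fun i => ?_) i <;> refine Fin.cases ?_ (fun j => ?_) j
  · exact Complex.measurable_ofReal.comp measurable_snd
  · exact hv j
  · exact Complex.continuous_conj.measurable.comp (hv i)
  · exact hM i j

theorem lintegral_hermitianOfCoords_succ (n : ℕ)
    {F : Matrix (Fin (n + 1)) (Fin (n + 1)) ℂ → ENNReal} (hF : Measurable F) :
    ∫⁻ c, F (hermitianOfCoords (n + 1) c) =
      ∫⁻ c, ∫⁻ v : Fin n → ℂ, ∫⁻ a : ℝ,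
        F (border (a : ℂ) v (star v) (hermitianOfCoords n c)) := by
  obtain ⟨T, hT, hTF⟩ := exists_measurePreserving_border n
  rw [← hT.lintegral_comp (f := fun c => F (hermitianOfCoords (n + 1) c))
    (hF.comp (measurable_hermitianOfCoords _))]
  have hm : Measurable fun q : (ℝ × (Fin n → ℝ)) ×
      ((Fin n → ℂ) × ({p : Fin n × Fin n // p.1 < p.2} → ℂ)) =>
      F (hermitianOfCoords (n + 1) (T q)) :=
    hF.comp ((measurable_hermitianOfCoords _).comp hT.measurable)
  have hm1 : Measurable fun p : ℝ × (Fin n → ℝ) =>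
      ∫⁻ q, F (hermitianOfCoords (n + 1) (T (p, q))) := hm.lintegral_prod_right'
  calc ∫⁻ q, F (hermitianOfCoords (n + 1) (T q))
      = ∫⁻ x, ∫⁻ a, ∫⁻ q, F (hermitianOfCoords (n + 1) (T ((a, x), q))) := by
        rw [Measure.volume_eq_prod, lintegral_prod _ hm.aemeasurable,
          Measure.volume_eq_prod ℝ, lintegral_prod_symm' _ hm1]
    _ = ∫⁻ x, ∫⁻ y, ∫⁻ v, ∫⁻ a, F (hermitianOfCoords (n + 1) (T ((a, x), (v, y)))) := by
        refine lintegral_congr fun x => ?_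
        have hx : Measurable fun r : ((Fin n → ℂ) × ({p : Fin n × Fin n // p.1 < p.2} → ℂ)) × ℝ =>
            F (hermitianOfCoords (n + 1) (T ((r.2, x), r.1))) :=
          hm.comp ((measurable_snd.prodMk measurable_const).prodMk measurable_fst)
        rw [lintegral_lintegral_swap
            (f := fun a q => F (hermitianOfCoords (n + 1) (T ((a, x), q))))
            (hx.comp measurable_swap).aemeasurable,
          Measure.volume_eq_prod, lintegral_prod_symm' _ hx.lintegral_prod_right']
    _ = _ := by
        simp only [hTF]
        have hx : Measurable fun r : HermitianCoords n =>
            ∫⁻ v : Fin n → ℂ, ∫⁻ a : ℝ,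
              F (border (a : ℂ) v (star v) (hermitianOfCoords n r)) := by
          refine Measurable.lintegral_prod_right' (f := fun s : HermitianCoords n × (Fin n → ℂ) =>
            ∫⁻ a : ℝ, F (border (a : ℂ) s.2 (star s.2) (hermitianOfCoords n s.1))) ?_
          refine Measurable.lintegral_prod_right'
            (f := fun t : (HermitianCoords n × (Fin n → ℂ)) × ℝ =>
              F (border (t.2 : ℂ) t.1.2 (star t.1.2) (hermitianOfCoords n t.1.1))) ?_
          exact hF.comp ((measurable_border n).comp
            ((((measurable_hermitianOfCoords n).comp (measurable_fst.comp measurable_fst)).prodMk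
              (measurable_snd.comp measurable_fst)).prodMk measurable_snd))
        rw [Measure.volume_eq_prod, lintegral_prod _ hx.aemeasurable]

/-! ### The Weyl integration formula for Hermitian matrices -/

/-- Invariance of a function of matrices under unitary conjugation. -/
def UnitarilyInvariant {n : ℕ} {γ : Type*} (F : Matrix (Fin n) (Fin n) ℂ → γ) : Prop :=
  ∀ U ∈ Matrix.unitaryGroup (Fin n) ℂ, ∀ M, F (U * M * star U) = F M

theorem UnitarilyInvariant.eq_diagonal {n : ℕ} {γ : Type*} {F : Matrix (Fin n) (Fin n) ℂ → γ}
    (hF : UnitarilyInvariant F) {M : Matrix (Fin n) (Fin n) ℂ} (hM : M.IsHermitian) :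
    F M = F (Matrix.diagonal fun i => (hM.eigenvalues i : ℂ)) := by
  have h := hM.spectral_theorem
  rw [Unitary.conjStarAlgAut_apply] at h
  conv_lhs => rw [h]
  exact hF _ hM.eigenvectorUnitary.2 _

/-- Hermitian matrices with the same characteristic polynomial are unitarily equivalent. -/
theorem UnitarilyInvariant.eq_of_charpoly_eq {n : ℕ} {γ : Type*}
    {F : Matrix (Fin n) (Fin n) ℂ → γ} (hF : UnitarilyInvariant F)
    {A B : Matrix (Fin n) (Fin n) ℂ} (hA : A.IsHermitian) (hB : B.IsHermitian)
    (h : A.charpoly = B.charpoly) : F A = F B := by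
  rw [hF.eq_diagonal hA, hF.eq_diagonal hB, (hA.eigenvalues_eq_eigenvalues_iff hB).2 h]

theorem isHermitian_border {n : ℕ} (a : ℝ) (v : Fin n → ℂ) {M : Matrix (Fin n) (Fin n) ℂ}
    (hM : M.IsHermitian) : (border (a : ℂ) v (star v) M).IsHermitian := by
  rw [Matrix.IsHermitian, star_border, hM.eq]
  simp

theorem isHermitian_diagonal_ofReal {n : ℕ} (x : Fin n → ℝ) :
    (Matrix.diagonal fun i => (x i : ℂ)).IsHermitian :=
  Matrix.isHermitian_diagonal_of_self_adjoint _ (by ext i; simp)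

theorem charpoly_diagonal_ofReal {n : ℕ} (x : Fin n → ℝ) :
    (Matrix.diagonal fun i => (x i : ℂ)).charpoly =
      (∏ k, (X - C (x k))).map (algebraMap ℝ ℂ) := by
  rw [Matrix.charpoly_diagonal, Polynomial.map_prod]
  simp

/-- The integral of `F` over all Hermitian matrices with lower right block `M`. -/
def borderIntegral {n : ℕ} (F : Matrix (Fin (n + 1)) (Fin (n + 1)) ℂ → ENNReal)
    (M : Matrix (Fin n) (Fin n) ℂ) : ENNReal :=
  ∫⁻ v : Fin n → ℂ, ∫⁻ a : ℝ, F (border (a : ℂ) v (star v) M)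

theorem measurable_borderIntegral {n : ℕ} {F : Matrix (Fin (n + 1)) (Fin (n + 1)) ℂ → ENNReal}
    (hF : Measurable F) : Measurable (borderIntegral F) := by
  refine Measurable.lintegral_prod_right'
    (f := fun s : Matrix (Fin n) (Fin n) ℂ × (Fin n → ℂ) =>
      ∫⁻ a : ℝ, F (border (a : ℂ) s.2 (star s.2) s.1)) ?_
  exact Measurable.lintegral_prod_right'
    (f := fun t : (Matrix (Fin n) (Fin n) ℂ × (Fin n → ℂ)) × ℝ =>
      F (border (t.2 : ℂ) t.1.2 (star t.1.2) t.1.1)) (hF.comp (measurable_border n))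

theorem unitarilyInvariant_borderIntegral {n : ℕ}
    {F : Matrix (Fin (n + 1)) (Fin (n + 1)) ℂ → ENNReal} (hF : Measurable F)
    (hinv : UnitarilyInvariant F) : UnitarilyInvariant (borderIntegral F) := by
  intro U hU M
  have hm : Measurable fun v : Fin n → ℂ =>
      ∫⁻ a : ℝ, F (border (a : ℂ) v (star v) (U * M * star U)) :=
    Measurable.lintegral_prod_right' (f := fun t : (Fin n → ℂ) × ℝ =>
      F (border (t.2 : ℂ) t.1 (star t.1) (U * M * star U)))
      (hF.comp ((measurable_border n).comp
        ((measurable_const.prodMk measurable_fst).prodMk measurable_snd)))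
  -- the rotation of the border that the conjugation produces preserves Lebesgue measure
  rw [borderIntegral, ← (measurePreserving_vecMul_unitary (Unitary.star_mem hU)).lintegral_comp hm]
  refine lintegral_congr fun v => lintegral_congr fun a => ?_
  rw [← border_conj, hinv _ (border_unitary hU)]

/-- The border of an arrow matrix with ordered diagonal `l` is traded for its eigenvalues. -/
theorem borderIntegral_diagonal {m : ℕ}
    {F : Matrix (Fin (m + 1)) (Fin (m + 1)) ℂ → ENNReal} (hF : Measurable F)
    (hinv : UnitarilyInvariant F) {l : Fin m → ℝ} (hl : StrictMono l) :
    borderIntegral F (Matrix.diagonal fun i => (l i : ℂ)) =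
      ENNReal.ofReal Real.pi ^ m * ∫⁻ x in interlacing l,
        ENNReal.ofReal (|vandermondeProd x| / |vandermondeProd l|) *
          F (Matrix.diagonal fun i => (x i : ℂ)) := by
  -- the arrow matrix whose border has the squared moduli `w`
  set A : (Fin m → ℝ) → ℝ → Matrix (Fin (m + 1)) (Fin (m + 1)) ℂ := fun w a =>
    border (a : ℂ) (fun i => (Real.sqrt (w i) : ℂ)) (star fun i => (Real.sqrt (w i) : ℂ))
      (Matrix.diagonal fun i => (l i : ℂ)) with hA
  have hAm : Measurable fun p : (Fin m → ℝ) × ℝ => F (A p.1 p.2) := by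
    refine hF.comp ((measurable_border m).comp
      ((measurable_const.prodMk (measurable_pi_lambda _ fun i => ?_)).prodMk measurable_snd))
    exact Complex.measurable_ofReal.comp ((measurable_pi_apply i).comp measurable_fst).sqrt
  have hAh : ∀ w a, (A w a).IsHermitian := fun w a =>
    isHermitian_border a _ (isHermitian_diagonal_ofReal l)
  have hAc : ∀ w a, (∀ i, 0 ≤ w i) →
      (A w a).charpoly = (arrowPoly l a w).map (algebraMap ℝ ℂ) := by
    intro w a hw
    rw [hA, charpoly_border_diagonal]
    congr 2
    ext i
    simp [Real.sq_sqrt (hw i)]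
  have h1 : borderIntegral F (Matrix.diagonal fun i => (l i : ℂ)) =
      ∫⁻ v : Fin m → ℂ, (fun w => ∫⁻ a, F (A w a)) (fun i => ‖v i‖ ^ 2) := by
    refine lintegral_congr fun v => lintegral_congr fun a => ?_
    refine hinv.eq_of_charpoly_eq (isHermitian_border a _ (isHermitian_diagonal_ofReal l))
      (hAh _ _) ?_
    rw [hAc _ _ (fun i => sq_nonneg _), charpoly_border_diagonal]
  rw [h1, lintegral_norm_sq hAm.lintegral_prod_right']
  congr 1
  have hpos : MeasurableSet (Set.univ.pi fun _ : Fin m => Set.Ioi (0 : ℝ)) :=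
    MeasurableSet.univ_pi fun _ => measurableSet_Ioi
  have hpos' : MeasurableSet {z : Fin (m + 1) → ℝ | ∀ i : Fin m, 0 < z i.succ} := by
    simp only [Set.ofPred_forall]
    exact MeasurableSet.iInter fun i => measurableSet_lt measurable_const (measurable_pi_apply _)
  -- corner and weights are put into one vector
  have h2 : ∫⁻ w in Set.univ.pi fun _ : Fin m => Set.Ioi (0 : ℝ), ∫⁻ a, F (A w a) =
      ∫⁻ z in {z : Fin (m + 1) → ℝ | ∀ i : Fin m, 0 < z i.succ},
        F (A (fun i => z i.succ) (z 0)) := by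
    set e := MeasurableEquiv.piFinSuccAbove (fun _ : Fin (m + 1) => ℝ) 0 with he
    have hmp : MeasurePreserving e volume volume :=
      volume_preserving_piFinSuccAbove (fun _ : Fin (m + 1) => ℝ) 0
    have hg : Measurable ((Set.univ.pi fun _ : Fin m => Set.Ioi (0 : ℝ)).indicator
        fun w => (∫⁻ a, F (A w a))) := hAm.lintegral_prod_right'.indicator hpos
    have hG : Measurable fun q : ℝ × (Fin m → ℝ) =>
        (Set.univ.pi fun _ : Fin m => Set.Ioi (0 : ℝ)).indicator (fun w => F (A w q.1)) q.2 := by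
      have : Measurable ((Prod.snd ⁻¹' (Set.univ.pi fun _ : Fin m => Set.Ioi (0 : ℝ))).indicator
          fun q : ℝ × (Fin m → ℝ) => F (A q.2 q.1)) :=
        (hAm.comp measurable_swap).indicator (measurable_snd hpos)
      exact this
    rw [← lintegral_indicator hpos, ← lintegral_indicator hpos']
    calc _ = ∫⁻ q : ℝ × (Fin m → ℝ),
        (Set.univ.pi fun _ : Fin m => Set.Ioi (0 : ℝ)).indicator (fun w => F (A w q.1)) q.2 := by
          rw [Measure.volume_eq_prod, lintegral_prod_symm' _ hG]
          refine lintegral_congr fun w => ?_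
          by_cases hw : w ∈ Set.univ.pi fun _ : Fin m => Set.Ioi (0 : ℝ)
          · simp only [Set.indicator_of_mem hw]
          · simp only [Set.indicator_of_notMem hw, lintegral_zero]
      _ = _ := by
          rw [← hmp.lintegral_comp hG]
          refine lintegral_congr fun z => ?_
          have hz0 : (e z).1 = z 0 := rfl
          have hzs : (e z).2 = fun i => z i.succ := rfl
          rw [hz0, hzs]
          simp only [Set.indicator, Set.mem_univ_pi, Set.mem_Ioi, Set.mem_ofPred_eq]
  rw [h2, lintegral_arrowMap hl]
  refine setLIntegral_congr_fun (measurableSet_interlacing l) fun x hx => ?_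
  congr 1
  refine hinv.eq_of_charpoly_eq (hAh _ _) (isHermitian_diagonal_ofReal x) ?_
  change (A (arrowWeight l x) (∑ k, x k - ∑ i, l i)).charpoly = _
  rw [hAc _ _ (fun i => (arrowWeight_pos hx i).le), charpoly_diagonal_ofReal,
    ← arrowPoly_arrowWeight hl.injective x]


theorem measurable_vandermondeProd (m : ℕ) : Measurable (vandermondeProd : (Fin m → ℝ) → ℝ) := by
  unfold vandermondeProd
  fun_prop

theorem measurable_diagonal_ofReal (n : ℕ) :
    Measurable fun x : Fin n → ℝ => (Matrix.diagonal fun i => (x i : ℂ)) := by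
  refine measurable_pi_lambda _ fun i => measurable_pi_lambda _ fun j => ?_
  simp only [Matrix.diagonal_apply]
  split_ifs
  · exact Complex.measurable_ofReal.comp (measurable_pi_apply i)
  · exact measurable_const

theorem measurableSet_strictMono (n : ℕ) : MeasurableSet {x : Fin n → ℝ | StrictMono x} := by
  have : {x : Fin n → ℝ | StrictMono x} = ⋂ i, ⋂ j, ⋂ (_ : i < j), {x | x i < x j} := by
    ext; simp [StrictMono]
  rw [this]
  exact MeasurableSet.iInter fun i => MeasurableSet.iInter fun j => MeasurableSet.iInter fun _ =>
    measurableSet_lt (measurable_pi_apply _) (measurable_pi_apply _)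

/-- Exchange of the order of integration over interlacing pairs; both members of such a pair are
increasing. -/
theorem lintegral_interlacing_swap {m : ℕ} {H : (Fin (m + 1) → ℝ) → ENNReal} (hH : Measurable H) :
    ∫⁻ l in {l : Fin m → ℝ | StrictMono l}, ∫⁻ x in interlacing l,
        ENNReal.ofReal |vandermondeProd l| * H x =
      ∫⁻ x in {x : Fin (m + 1) → ℝ | StrictMono x},
        ENNReal.ofReal (|vandermondeProd x| / (m.factorial : ℝ)) * H x := by
  have hS : MeasurableSet {p : (Fin m → ℝ) × (Fin (m + 1) → ℝ) | p.2 ∈ interlacing p.1} := by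
    have : {p : (Fin m → ℝ) × (Fin (m + 1) → ℝ) | p.2 ∈ interlacing p.1} =
        ⋂ i : Fin m, ({p | p.2 i.castSucc < p.1 i} ∩ {p | p.1 i < p.2 i.succ}) := by
      ext; simp [interlacing]
    rw [this]
    exact MeasurableSet.iInter fun i =>
      (measurableSet_lt (by fun_prop) (by fun_prop)).inter
        (measurableSet_lt (by fun_prop) (by fun_prop))
  set Φ : (Fin m → ℝ) → (Fin (m + 1) → ℝ) → ENNReal := fun l x =>
    {p : (Fin m → ℝ) × (Fin (m + 1) → ℝ) | p.2 ∈ interlacing p.1}.indicator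
      (fun p => ENNReal.ofReal |vandermondeProd p.1| * H p.2) (l, x) with hΦ
  have hΦm : Measurable (Function.uncurry Φ) := by
    refine Measurable.indicator ?_ hS
    have := measurable_vandermondeProd m
    fun_prop
  have hΦl : ∀ l, ∫⁻ x, Φ l x =
      ∫⁻ x in interlacing l, ENNReal.ofReal |vandermondeProd l| * H x := fun l => by
    rw [← lintegral_indicator (measurableSet_interlacing l)]
    rfl
  have hleft : MeasurableSet {l : Fin m → ℝ | StrictMono l} := measurableSet_strictMono m
  have hright := measurableSet_strictMono (m + 1)
  have h1 : ∫⁻ l in {l : Fin m → ℝ | StrictMono l}, ∫⁻ x in interlacing l,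
      ENNReal.ofReal |vandermondeProd l| * H x = ∫⁻ l, ∫⁻ x, Φ l x := by
    rw [← lintegral_indicator hleft]
    refine lintegral_congr fun l => ?_
    rw [hΦl]
    by_cases hl : StrictMono l
    · exact Set.indicator_of_mem (s := {l : Fin m → ℝ | StrictMono l}) hl _
    · rw [Set.indicator_of_notMem (s := {l : Fin m → ℝ | StrictMono l}) hl]
      have : interlacing l = ∅ :=
        Set.eq_empty_of_forall_notMem fun x hx => hl (interlacing_strictMono_left hx)
      simp [this]
  rw [h1, lintegral_lintegral_swap hΦm.aemeasurable, ← lintegral_indicator hright]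
  refine lintegral_congr fun x => ?_
  have hx2 : ∫⁻ l, Φ l x = (∫⁻ l in {l : Fin m → ℝ | x ∈ interlacing l},
      ENNReal.ofReal |vandermondeProd l|) * H x := by
    have hSx : MeasurableSet {l : Fin m → ℝ | x ∈ interlacing l} :=
      (measurable_id.prodMk measurable_const) hS
    rw [← lintegral_mul_const _ (measurable_vandermondeProd m).abs.ennreal_ofReal,
      ← lintegral_indicator hSx]
    rfl
  rw [hx2]
  by_cases hx : StrictMono x
  · rw [Set.indicator_of_mem (s := {x : Fin (m + 1) → ℝ | StrictMono x}) hx,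
      lintegral_vandermondeProd_interlacing hx]
  · rw [Set.indicator_of_notMem (s := {x : Fin (m + 1) → ℝ | StrictMono x}) hx]
    have : {l : Fin m → ℝ | x ∈ interlacing l} = ∅ :=
      Set.eq_empty_of_forall_notMem fun l hl => hx (interlacing_strictMono hl)
    simp [this]

/-- **Weyl's integration formula** in ordered eigenvalues. -/
theorem lintegral_hermitianOfCoords (n : ℕ) {F : Matrix (Fin n) (Fin n) ℂ → ENNReal}
    (hF : Measurable F) (hinv : UnitarilyInvariant F) :
    ∫⁻ c, F (hermitianOfCoords n c) =
      ENNReal.ofReal (Real.pi ^ (n * (n - 1) / 2) / ∏ j ∈ Finset.range n, (j.factorial : ℝ)) *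
        ∫⁻ x in {x : Fin n → ℝ | StrictMono x},
          ENNReal.ofReal (vandermondeProd x ^ 2) * F (Matrix.diagonal fun i => (x i : ℂ)) := by
  induction n with
  | zero =>
    have h1 : ∀ c, F (hermitianOfCoords 0 c) = F 0 := fun c => congrArg F (Subsingleton.elim _ _)
    have h2 : ∀ x : Fin 0 → ℝ, F (Matrix.diagonal fun i => (x i : ℂ)) = F 0 := fun x =>
      congrArg F (Subsingleton.elim _ _)
    have h3 : {x : Fin 0 → ℝ | StrictMono x} = Set.univ :=
      Set.eq_univ_of_forall fun x i => i.elim0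
    have : IsEmpty {p : Fin 0 × Fin 0 // p.1 < p.2} := ⟨fun p => p.1.1.elim0⟩
    simp only [h1, h2, h3, lintegral_const, Measure.restrict_univ]
    rw [Measure.volume_eq_prod, ← Set.univ_prod_univ, Measure.prod_prod]
    simp [vandermondeProd, volume_pi]
  | succ m ih =>
    rw [lintegral_hermitianOfCoords_succ m hF]
    change ∫⁻ c, borderIntegral F (hermitianOfCoords m c) = _
    rw [ih (measurable_borderIntegral hF) (unitarilyInvariant_borderIntegral hF hinv)]
    have hH : Measurable fun x : Fin (m + 1) → ℝ =>
        ENNReal.ofReal |vandermondeProd x| * F (Matrix.diagonal fun i => (x i : ℂ)) :=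
      (measurable_vandermondeProd _).abs.ennreal_ofReal.mul
        (hF.comp (measurable_diagonal_ofReal _))
    have h1 : ∫⁻ l in {l : Fin m → ℝ | StrictMono l}, ENNReal.ofReal (vandermondeProd l ^ 2) *
          borderIntegral F (Matrix.diagonal fun i => (l i : ℂ)) =
        ENNReal.ofReal Real.pi ^ m * ∫⁻ l in {l : Fin m → ℝ | StrictMono l},
          ∫⁻ x in interlacing l, ENNReal.ofReal |vandermondeProd l| *
            (ENNReal.ofReal |vandermondeProd x| * F (Matrix.diagonal fun i => (x i : ℂ))) := by
      rw [← lintegral_const_mul' _ _ (by finiteness)]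
      refine setLIntegral_congr_fun (measurableSet_strictMono m) fun l hl => ?_
      have hl' : StrictMono l := hl
      rw [borderIntegral_diagonal hF hinv hl', mul_left_comm,
        ← lintegral_const_mul' _ _ (by finiteness)]
      congr 1
      refine lintegral_congr fun x => ?_
      rw [← mul_assoc, ← mul_assoc, ← ENNReal.ofReal_mul (sq_nonneg _),
        ← ENNReal.ofReal_mul (abs_nonneg _)]
      congr 2
      have := abs_ne_zero.2 (vandermondeProd_ne_zero hl'.injective)
      rw [← sq_abs]
      field_simp
    rw [h1, lintegral_interlacing_swap hH, ← mul_assoc, ← ENNReal.ofReal_pow Real.pi_pos.le,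
      ← ENNReal.ofReal_mul (by positivity)]
    have h2 : ∀ x : Fin (m + 1) → ℝ, ENNReal.ofReal (|vandermondeProd x| / (m.factorial : ℝ)) *
        (ENNReal.ofReal |vandermondeProd x| * F (Matrix.diagonal fun i => (x i : ℂ))) =
        ENNReal.ofReal (m.factorial : ℝ)⁻¹ * (ENNReal.ofReal (vandermondeProd x ^ 2) *
          F (Matrix.diagonal fun i => (x i : ℂ))) := fun x => by
      rw [← mul_assoc, ← mul_assoc, ← ENNReal.ofReal_mul (by positivity),
        ← ENNReal.ofReal_mul (by positivity), ← sq_abs (vandermondeProd x)]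
      congr 2
      ring
    simp only [h2]
    rw [lintegral_const_mul' _ _ (by finiteness), ← mul_assoc,
      ← ENNReal.ofReal_mul (by positivity), Finset.prod_range_succ]
    congr 2
    have h3 : (m + 1) * (m + 1 - 1) / 2 = m * (m - 1) / 2 + m := by
      have := Nat.triangle_succ m
      simpa using this
    rw [h3, pow_add]
    field_simp

/-! ### Unordered eigenvalues -/

theorem ae_injective (n : ℕ) : ∀ᵐ x : Fin n → ℝ, Function.Injective x := by
  have h : ∀ i j : Fin n, i ≠ j → ∀ᵐ x : Fin n → ℝ, x i ≠ x j := by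
    intro i j hij
    set s : Submodule ℝ (Fin n → ℝ) :=
      LinearMap.ker (LinearMap.proj (R := ℝ) (φ := fun _ : Fin n => ℝ) i - LinearMap.proj j) with hs
    have hne : s ≠ ⊤ := by
      intro h
      have : (Pi.single i 1 : Fin n → ℝ) ∈ s := h ▸ Submodule.mem_top
      simp [hs, hij] at this
    have := Measure.addHaar_submodule volume s hne
    rw [ae_iff]
    convert this using 2
    ext x
    simp [hs, sub_eq_zero]
  have h2 : ∀ᵐ x : Fin n → ℝ, ∀ i j : Fin n, i ≠ j → x i ≠ x j := by
    rw [ae_all_iff]; intro i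
    rw [ae_all_iff]; intro j
    by_cases hij : i = j
    · simp [hij]
    · filter_upwards [h i j hij] with x hx _ using hx
  filter_upwards [h2] with x hx i j hij
  by_contra hne
  exact hx i j hne hij

/-- Up to a null set `ℝ^n` is the disjoint union of the `n!` permuted copies of the chamber of
increasing vectors. -/
theorem lintegral_eq_factorial_mul_strictMono {n : ℕ} {g : (Fin n → ℝ) → ENNReal}
    (hg : ∀ (σ : Equiv.Perm (Fin n)) x, g (x ∘ σ) = g x) :
    ∫⁻ x, g x = (n.factorial : ENNReal) * ∫⁻ x in {x : Fin n → ℝ | StrictMono x}, g x := by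
  have hSM : MeasurableSet {x : Fin n → ℝ | StrictMono x} := measurableSet_strictMono n
  set S : Equiv.Perm (Fin n) → Set (Fin n → ℝ) := fun σ => {x | StrictMono (x ∘ σ)} with hS
  have hperm : ∀ σ : Equiv.Perm (Fin n), MeasurableSet (S σ) ∧
      ∫⁻ x in S σ, g x = ∫⁻ x in {x : Fin n → ℝ | StrictMono x}, g x := by
    intro σ
    set e := MeasurableEquiv.piCongrLeft (fun _ : Fin n => ℝ) σ.symm with he
    have hmp : MeasurePreserving e volume volume := volume_measurePreserving_piCongrLeft _ _
    have hex : ∀ x, e x = x ∘ σ := fun x => by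
      ext i
      have := MeasurableEquiv.piCongrLeft_apply_apply σ.symm (β := fun _ => ℝ) x (σ i)
      simpa using this
    have hpre : e ⁻¹' {x : Fin n → ℝ | StrictMono x} = S σ := by
      ext x; simp [hS, hex]
    refine ⟨hpre ▸ e.measurable hSM, ?_⟩
    have h := hmp.setLIntegral_comp_preimage_emb e.measurableEmbedding g
      {x : Fin n → ℝ | StrictMono x}
    rw [hpre] at h
    simpa only [hex, hg] using h
  have hdisj : Pairwise (Function.onFun Disjoint S) := by
    intro σ τ hne
    refine Set.disjoint_left.2 fun x hx hy => hne ?_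
    have h : x ∘ σ = x ∘ τ := (StrictMono.range_inj hx hy).1 (by
      rw [Set.range_comp, Set.range_comp, σ.surjective.range_eq, τ.surjective.range_eq])
    have hinj : Function.Injective x := fun i j hij => by
      have := StrictMono.injective (f := x ∘ σ) hx (a₁ := σ.symm i) (a₂ := σ.symm j) (by simpa)
      exact σ.symm.injective this
    exact Equiv.ext fun i => hinj (congrFun h i)
  have hunion : (⋃ σ, S σ) =ᵐ[volume] Set.univ := by
    rw [Filter.eventuallyEq_univ]
    filter_upwards [ae_injective n] with x hx
    exact Set.mem_iUnion.2 ⟨Tuple.sort x,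
      (Tuple.monotone_sort x).strictMono_of_injective (hx.comp (Tuple.sort x).injective)⟩
  rw [← setLIntegral_univ, ← setLIntegral_congr hunion,
    lintegral_iUnion (fun σ => (hperm σ).1) hdisj, tsum_fintype]
  simp only [fun σ => (hperm σ).2]
  simp [Fintype.card_perm]

/-! ### The Hermitian matrix integral -/

/-- The eigenvalue condition in terms of the characteristic polynomial, which makes its invariance
under conjugation plain. -/
theorem mem_hermitianWithSpectrumIn {n : ℕ} {J : Set ℝ} {M : Matrix (Fin n) (Fin n) ℂ} :
    M ∈ hermitianWithSpectrumIn n J ↔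
      M.IsHermitian ∧ ∀ t : ℝ, M.charpoly.eval (t : ℂ) = 0 → t ∈ J := by
  have key : ∀ (hM : M.IsHermitian) (t : ℝ),
      M.charpoly.eval (t : ℂ) = 0 ↔ ∃ i, hM.eigenvalues i = t := by
    intro hM t
    rw [hM.charpoly_eq, eval_prod, Finset.prod_eq_zero_iff]
    simp only [Finset.mem_univ, true_and, eval_sub, eval_X, eval_C, sub_eq_zero]
    exact exists_congr fun i => ⟨fun h => (Complex.ofReal_injective h).symm, fun h => h ▸ rfl⟩
  constructor
  · rintro ⟨hM, h⟩
    refine ⟨hM, fun t ht => ?_⟩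
    obtain ⟨i, rfl⟩ := (key hM t).1 ht
    exact h i
  · rintro ⟨hM, h⟩
    exact ⟨hM, fun i => h _ ((key hM _).2 ⟨i, rfl⟩)⟩

theorem diagonal_mem_hermitianWithSpectrumIn {n : ℕ} {J : Set ℝ} {x : Fin n → ℝ} :
    (Matrix.diagonal fun i => (x i : ℂ)) ∈ hermitianWithSpectrumIn n J ↔ ∀ i, x i ∈ J := by
  have key : ∀ t : ℝ, (Matrix.diagonal fun i => (x i : ℂ)).charpoly.eval (t : ℂ) = 0 ↔
      ∃ i, x i = t := by
    intro t
    rw [Matrix.charpoly_diagonal, eval_prod, Finset.prod_eq_zero_iff]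
    simp [sub_eq_zero, eq_comm]
  simp only [mem_hermitianWithSpectrumIn, isHermitian_diagonal_ofReal, true_and, key]
  exact ⟨fun h i => h _ ⟨i, rfl⟩, fun h t ⟨i, hi⟩ => hi ▸ h i⟩

theorem unitary_conj_mem_hermitianWithSpectrumIn {n : ℕ} {J : Set ℝ}
    {U : Matrix (Fin n) (Fin n) ℂ} (hU : U ∈ Matrix.unitaryGroup (Fin n) ℂ)
    {M : Matrix (Fin n) (Fin n) ℂ} (hM : M ∈ hermitianWithSpectrumIn n J) :
    U * M * star U ∈ hermitianWithSpectrumIn n J := by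
  rw [mem_hermitianWithSpectrumIn] at hM ⊢
  refine ⟨?_, ?_⟩
  · rw [Matrix.star_eq_conjTranspose]
    exact Matrix.isHermitian_mul_mul_conjTranspose U hM.1
  · rw [Matrix.charpoly_mul_comm, ← mul_assoc, Matrix.mem_unitaryGroup_iff'.1 hU, one_mul]
    exact hM.2

/-- Closedness, which gives measurability: the set is the projection of a closed set along the
compact set of possible eigenvalues. -/
theorem isClosed_hermitianWithSpectrumIn (n : ℕ) {J : Set ℝ} (hJ : IsCompact J) :
    IsClosed (hermitianWithSpectrumIn n J) := by
  set K : Set (Fin n → ℝ) := Set.univ.pi fun _ => J with hK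
  have hKc : IsCompact K := isCompact_univ_pi fun _ => hJ
  have : CompactSpace K := isCompact_iff_compactSpace.1 hKc
  set S : Set (Matrix (Fin n) (Fin n) ℂ × K) :=
    {p | p.1ᴴ = p.1} ∩ ⋂ t : ℂ, {p | (Matrix.scalar (Fin n) t - p.1).det =
      ∏ i, (t - ((p.2 : Fin n → ℝ) i : ℂ))} with hS
  have hSc : IsClosed S := by
    refine IsClosed.inter (isClosed_eq ?_ ?_) (isClosed_iInter fun t => isClosed_eq ?_ ?_)
    · exact continuous_fst.matrix_conjTranspose
    · exact continuous_fst
    · exact (continuous_const.sub continuous_fst).matrix_det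
    · exact continuous_finsetProd _ fun i _ => continuous_const.sub
        (Complex.continuous_ofReal.comp
          ((continuous_apply i).comp (continuous_subtype_val.comp continuous_snd)))
  have himg : hermitianWithSpectrumIn n J = Prod.fst '' S := by
    ext M
    constructor
    · rintro ⟨hM, h⟩
      refine ⟨(M, ⟨hM.eigenvalues, fun i _ => h i⟩), ⟨hM, Set.mem_iInter.2 fun t => ?_⟩, rfl⟩
      have h1 := congrArg (fun p => p.eval t) hM.charpoly_eq
      simp only [Matrix.eval_charpoly, eval_prod, eval_sub, eval_X, eval_C] at h1
      exact h1
    · rintro ⟨⟨M', y⟩, ⟨h1, h2⟩, rfl⟩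
      refine mem_hermitianWithSpectrumIn.2 ⟨h1, fun t ht => ?_⟩
      have h3 := Set.mem_iInter.1 h2 (t : ℂ)
      rw [Matrix.eval_charpoly] at ht
      rw [Set.mem_ofPred_eq, ht, eq_comm, Finset.prod_eq_zero_iff] at h3
      obtain ⟨i, -, hi⟩ := h3
      have : t = (y : Fin n → ℝ) i := by exact_mod_cast sub_eq_zero.1 hi
      rw [this]
      exact y.2 i (Set.mem_univ i)
  rw [himg]
  exact isClosedMap_fst_of_compactSpace S hSc

theorem unitarilyInvariant_det_one_add_sq (n : ℕ) :
    UnitarilyInvariant fun M : Matrix (Fin n) (Fin n) ℂ => (1 + M ^ 2).det := by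
  intro U hU M
  have h1 := Matrix.mem_unitaryGroup_iff'.1 hU
  have h2 := Matrix.mem_unitaryGroup_iff.1 hU
  have h3 : 1 + (U * M * star U) ^ 2 = U * (1 + M ^ 2) * star U := by
    have : (U * M * star U) ^ 2 = U * M ^ 2 * star U := by
      rw [sq, sq]
      calc U * M * star U * (U * M * star U) = U * M * (star U * U) * M * star U := by
            simp only [mul_assoc]
        _ = _ := by rw [h1]; simp only [mul_assoc, mul_one]
    rw [this, mul_add, add_mul, mul_one, h2]
  simp only
  rw [h3, Matrix.det_mul, Matrix.det_mul, mul_right_comm, ← Matrix.det_mul, h2, Matrix.det_one,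
    one_mul]

theorem det_one_add_diagonal_sq {n : ℕ} (x : Fin n → ℝ) :
    (1 + (Matrix.diagonal fun i => (x i : ℂ)) ^ 2).det = ((∏ i, (1 + x i ^ 2) : ℝ) : ℂ) := by
  rw [Matrix.diagonal_pow, ← Matrix.diagonal_one, Matrix.diagonal_add, Matrix.det_diagonal]
  simp

theorem prod_range_factorial (n : ℕ) : ∏ j ∈ Finset.range n, (j.factorial : ℝ) =
    ∏ j ∈ Finset.Icc 1 (n - 1), (j.factorial : ℝ) := by
  cases n with
  | zero => simp
  | succ m =>
    rw [Finset.prod_range_succ', Nat.factorial_zero, Nat.cast_one, mul_one, Nat.add_sub_cancel]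
    induction m with
    | zero => simp
    | succ k ih => rw [Finset.prod_range_succ, ih, Finset.prod_Icc_succ_top (by omega)]

theorem unitaryVolume_pos (n : ℕ) : 0 < unitaryVolume n := by
  unfold unitaryVolume
  have := Real.pi_pos
  positivity

theorem vandermondeProd_sq_comp_perm {n : ℕ} (x : Fin n → ℝ) (σ : Equiv.Perm (Fin n)) :
    vandermondeProd (x ∘ σ) ^ 2 = vandermondeProd x ^ 2 := by
  rw [← sq_abs, ← sq_abs (vandermondeProd x), abs_vandermondeProd, abs_vandermondeProd]
  have : Matrix.vandermonde (x ∘ σ) = (Matrix.vandermonde x).submatrix σ id := by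
    ext; simp [Matrix.vandermonde_apply]
  rw [this, Matrix.det_permute, abs_mul]
  rcases Int.units_eq_one_or (Equiv.Perm.sign σ) with h | h <;> simp [h]

/-- Weyl's formula for the function `det (1 + M²)⁻ⁿ` cut off to the matrices with
spectrum in `J`. -/
theorem integral_hermitianWithSpectrumIn (n : ℕ) {J : Set ℝ} (hJ : IsCompact J) :
    ∫ M in hermitianWithSpectrumIn n J, 1 / (1 + M ^ 2).det ^ n ∂(hermitianLebesgue n) =
      ((unitaryVolume n * ∫ t in Set.univ.pi (fun _ : Fin n => J),
        vandermondeProd t ^ 2 * ((∏ k, (1 + t k ^ 2)) ^ n)⁻¹ : ℝ) : ℂ) := by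
  set S := hermitianWithSpectrumIn n J with hS
  set f : Matrix (Fin n) (Fin n) ℂ → ℂ := fun M => 1 / (1 + M ^ 2).det ^ n with hf
  have hSm : MeasurableSet S := (isClosed_hermitianWithSpectrumIn n hJ).measurableSet
  have hfm : Measurable f := by
    have : Measurable fun M : Matrix (Fin n) (Fin n) ℂ => (1 + M ^ 2).det :=
      (continuous_const.add (continuous_id.pow 2)).matrix_det.measurable
    exact measurable_const.div (this.pow_const n)
  have hfinv : UnitarilyInvariant f := fun U hU M => by
    simp only [hf, unitarilyInvariant_det_one_add_sq n U hU M]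
  have hfd : ∀ x : Fin n → ℝ, f (Matrix.diagonal fun i => (x i : ℂ)) =
      ((((∏ k, (1 + x k ^ 2)) ^ n)⁻¹ : ℝ) : ℂ) := fun x => by
    simp only [hf, det_one_add_diagonal_sq]
    push_cast
    rw [one_div]
  have hpos : ∀ x : Fin n → ℝ, 0 ≤ ((∏ k, (1 + x k ^ 2)) ^ n)⁻¹ := fun x => by positivity
  -- on Hermitian matrices the integrand is a nonnegative real, so a lower integral computes it
  have hfnorm : ∀ M ∈ S, f M = ((‖f M‖ : ℝ) : ℂ) := by
    rintro M ⟨hM, -⟩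
    rw [hfinv.eq_diagonal hM, hfd, Complex.norm_real, Real.norm_of_nonneg (hpos _)]
  set F : Matrix (Fin n) (Fin n) ℂ → ENNReal := S.indicator fun M => ‖f M‖ₑ with hF
  have hFm : Measurable F := hfm.enorm.indicator hSm
  have hFinv : UnitarilyInvariant F := by
    intro U hU M
    by_cases hM : M ∈ S
    · rw [hF, Set.indicator_of_mem hM,
        Set.indicator_of_mem (unitary_conj_mem_hermitianWithSpectrumIn hU hM), hfinv U hU]
    · rw [hF, Set.indicator_of_notMem hM, Set.indicator_of_notMem]
      intro h
      have h2 := unitary_conj_mem_hermitianWithSpectrumIn (Unitary.star_mem hU) h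
      have h1 := Matrix.mem_unitaryGroup_iff'.1 hU
      rw [star_star, ← mul_assoc, ← mul_assoc, h1, one_mul, mul_assoc, h1, mul_one] at h2
      exact hM h2
  have hKm : MeasurableSet (Set.univ.pi fun _ : Fin n => J) :=
    MeasurableSet.univ_pi fun _ => hJ.isClosed.measurableSet
  have hsym : ∀ (σ : Equiv.Perm (Fin n)) (x : Fin n → ℝ),
      ENNReal.ofReal (vandermondeProd (x ∘ σ) ^ 2) *
        F (Matrix.diagonal fun i => ((x ∘ σ) i : ℂ)) =
      ENNReal.ofReal (vandermondeProd x ^ 2) * F (Matrix.diagonal fun i => (x i : ℂ)) := by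
    intro σ x
    rw [vandermondeProd_sq_comp_perm]
    congr 1
    refine hFinv.eq_of_charpoly_eq (isHermitian_diagonal_ofReal _)
      (isHermitian_diagonal_ofReal _) ?_
    rw [Matrix.charpoly_diagonal, Matrix.charpoly_diagonal]
    exact Equiv.prod_comp σ fun i => X - C (x i : ℂ)
  have h1 : ∫⁻ M in S, ‖f M‖ₑ ∂(hermitianLebesgue n) =
      ENNReal.ofReal (unitaryVolume n) * ∫⁻ t in Set.univ.pi (fun _ : Fin n => J),
        ENNReal.ofReal (vandermondeProd t ^ 2 * ((∏ k, (1 + t k ^ 2)) ^ n)⁻¹) := by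
    rw [← lintegral_indicator hSm, hermitianLebesgue,
      lintegral_map hFm (measurable_hermitianOfCoords n), lintegral_hermitianOfCoords n hFm hFinv]
    have h2 := lintegral_eq_factorial_mul_strictMono (g := fun x => ENNReal.ofReal
      (vandermondeProd x ^ 2) * F (Matrix.diagonal fun i => (x i : ℂ))) hsym
    have h3 : ENNReal.ofReal
        (Real.pi ^ (n * (n - 1) / 2) / ∏ j ∈ Finset.range n, (j.factorial : ℝ)) =
        ENNReal.ofReal (unitaryVolume n) * (n.factorial : ENNReal) := by
      rw [← ENNReal.ofReal_natCast, ← ENNReal.ofReal_mul (unitaryVolume_pos n).le,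
        prod_range_factorial, unitaryVolume]
      congr 1
      have := Nat.factorial_pos n
      field_simp
    rw [h3, mul_assoc, ← h2, ← lintegral_indicator hKm]
    congr 1
    refine lintegral_congr fun x => ?_
    by_cases hx : ∀ i, x i ∈ J
    · rw [Set.indicator_of_mem (by simpa using hx), hF,
        Set.indicator_of_mem (diagonal_mem_hermitianWithSpectrumIn.2 hx), hfd,
        ENNReal.ofReal_mul (sq_nonneg _)]
      congr 1
      rw [← ofReal_norm, Complex.norm_real, Real.norm_of_nonneg (hpos _)]
    · rw [Set.indicator_of_notMem (by simpa using hx), hF,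
        Set.indicator_of_notMem (fun h => hx (diagonal_mem_hermitianWithSpectrumIn.1 h)), mul_zero]
  rw [setIntegral_congr_fun hSm hfnorm, integral_complex_ofReal,
    integral_norm_eq_lintegral_enorm hfm.aestronglyMeasurable, h1, ENNReal.toReal_mul,
    ENNReal.toReal_ofReal (unitaryVolume_pos n).le,
    ← integral_eq_lintegral_of_nonneg_ae]
  · exact Filter.Eventually.of_forall fun x => mul_nonneg (sq_nonneg _) (hpos x)
  · refine Measurable.aestronglyMeasurable ?_
    have := measurable_vandermondeProd n
    fun_prop

/-! ### Products over pairs -/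

theorem prod_Ioi_mul_self {R : Type*} [CommMonoid R] {n : ℕ} (q : Fin n → R) :
    ∏ i, ∏ j ∈ Finset.Ioi i, q j * q i = (∏ i, q i) ^ (n - 1) := by
  rw [Finset.prod_prod_Ioi_mul_eq_prod_prod_off_diag (fun i _ => q i), ← Finset.prod_pow,
    Finset.prod_comm' (t' := Finset.univ) (s' := fun j => {j}ᶜ) (by simp [eq_comm])]
  refine Finset.prod_congr rfl fun i _ => ?_
  simp [Finset.card_compl]

theorem prod_Ioi_const {R : Type*} [CommMonoid R] {n : ℕ} (c : R) :
    ∏ i : Fin n, ∏ _j ∈ Finset.Ioi i, c = c ^ (n * (n - 1) / 2) := by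
  simp only [Finset.prod_const, Fin.card_Ioi]
  rw [Finset.prod_pow_eq_pow_sum, Fin.sum_univ_eq_sum_range (fun i => n - 1 - i) n,
    Finset.sum_range_reflect (fun i => i) n, Finset.sum_range_id]

theorem two_mul_triangle (n : ℕ) : n * (n - 1) / 2 * 2 = n * (n - 1) :=
  Nat.div_mul_cancel (Nat.even_mul_pred_self n).two_dvd

/-! ### The interaction in different coordinates -/

theorem norm_exp_sub_exp_sq (a b : ℝ) :
    ‖Complex.exp (Complex.I * (a : ℂ)) - Complex.exp (Complex.I * (b : ℂ))‖ ^ 2 =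
      4 * Real.sin ((a - b) / 2) ^ 2 := by
  have h : Complex.exp (Complex.I * (a : ℂ)) - Complex.exp (Complex.I * (b : ℂ)) =
      Complex.exp (Complex.I * (b : ℂ)) * (Complex.exp (Complex.I * ((a - b : ℝ) : ℂ)) - 1) := by
    rw [mul_sub, ← Complex.exp_add, mul_one]
    congr 2
    push_cast
    ring
  rw [h, norm_mul, mul_comm Complex.I (b : ℂ), Complex.norm_exp_ofReal_mul_I, one_mul,
    Complex.norm_exp_I_mul_ofReal_sub_one, Real.norm_eq_abs, sq_abs]
  ring

theorem circularInteraction_eq_sin {n : ℕ} (θ : Fin n → ℝ) :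
    circularInteraction θ =
      2 ^ (n * (n - 1)) * ∏ i, ∏ j ∈ Finset.Ioi i, Real.sin ((θ i - θ j) / 2) ^ 2 := by
  simp only [circularInteraction, norm_exp_sub_exp_sq, Finset.prod_mul_distrib]
  rw [prod_Ioi_const, show (4 : ℝ) = 2 ^ 2 by norm_num, ← pow_mul, mul_comm 2, two_mul_triangle]

theorem circularInteraction_two_arctan {n : ℕ} (t : Fin n → ℝ) :
    circularInteraction (fun k => 2 * Real.arctan (t k)) =
      2 ^ (n * (n - 1)) * vandermondeProd t ^ 2 * ((∏ k, (1 + t k ^ 2)) ^ (n - 1))⁻¹ := by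
  have hsin : ∀ a b : ℝ, Real.sin ((2 * Real.arctan a - 2 * Real.arctan b) / 2) ^ 2 =
      (a - b) ^ 2 * ((1 + b ^ 2) * (1 + a ^ 2))⁻¹ := by
    intro a b
    have ha : 0 < 1 + a ^ 2 := by positivity
    have hb : 0 < 1 + b ^ 2 := by positivity
    rw [show (2 * Real.arctan a - 2 * Real.arctan b) / 2 = Real.arctan a - Real.arctan b by ring,
      Real.sin_sub, Real.sin_arctan, Real.sin_arctan, Real.cos_arctan, Real.cos_arctan]
    have h : a / √(1 + a ^ 2) * (1 / √(1 + b ^ 2)) - 1 / √(1 + a ^ 2) * (b / √(1 + b ^ 2)) =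
        (a - b) / (√(1 + a ^ 2) * √(1 + b ^ 2)) := by
      field_simp
    rw [h, div_pow, mul_pow, Real.sq_sqrt ha.le, Real.sq_sqrt hb.le, mul_comm (1 + b ^ 2),
      div_eq_mul_inv]
  rw [circularInteraction_eq_sin, mul_assoc]
  congr 1
  simp only [hsin, Finset.prod_mul_distrib, vandermondeProd, ← Finset.prod_pow]
  congr 1
  rw [Finset.prod_pow, ← prod_Ioi_mul_self (fun k => 1 + t k ^ 2)]
  simp only [Finset.prod_inv_distrib]

theorem exp_neg_mul_sum_log {n : ℕ} (t : Fin n → ℝ) :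
    Real.exp (-(n : ℝ) * ∑ k, Real.log (1 + t k ^ 2)) = ((∏ k, (1 + t k ^ 2)) ^ n)⁻¹ := by
  have h : ∀ k, 0 < 1 + t k ^ 2 := fun k => by positivity
  rw [neg_mul, Real.exp_neg, ← Real.log_prod (fun k _ => (h k).ne'), ← Real.log_pow, Real.exp_log]
  have := Finset.prod_pos fun k (_ : k ∈ Finset.univ) => h k
  positivity

/-- On the unit circle `|u - v|² = - (u - v)² / (u v)`. -/
theorem norm_sub_sq_mul {u v : ℂ} (hu : ‖u‖ = 1) (hv : ‖v‖ = 1) :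
    ((‖u - v‖ ^ 2 : ℝ) : ℂ) * (v * u) = -1 * (u - v) ^ 2 := by
  have h1 : u * (starRingEnd ℂ) u = 1 := by
    rw [Complex.mul_conj, Complex.normSq_eq_norm_sq, hu]; simp
  have h2 : v * (starRingEnd ℂ) v = 1 := by
    rw [Complex.mul_conj, Complex.normSq_eq_norm_sq, hv]; simp
  rw [← Complex.normSq_eq_norm_sq, ← Complex.mul_conj, map_sub]
  linear_combination (u - v) * (v * h1) - (u - v) * (u * h2)

/-- The contour integrand, with `du_k = i u_k dθ_k`, in terms of the angles. -/
theorem contour_integrand {n : ℕ} (θ : Fin n → ℝ) :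
    (-1) ^ (n * (n + 1) / 2) * Complex.I ^ n *
      ((vandermondeProd (fun k => Complex.exp (Complex.I * (θ k : ℂ))) ^ 2 *
        Complex.exp (-(n : ℂ) * ∑ k, Complex.log (Complex.exp (Complex.I * (θ k : ℂ))))) *
        ∏ k, (Complex.I * Complex.exp (Complex.I * (θ k : ℂ)))) =
      (circularInteraction θ : ℂ) := by
  set u : Fin n → ℂ := fun k => Complex.exp (Complex.I * (θ k : ℂ)) with hu
  have hu0 : ∀ k, u k ≠ 0 := fun k => Complex.exp_ne_zero _
  have hu1 : ∀ k, ‖u k‖ = 1 := fun k => by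
    rw [hu]; simp only; rw [mul_comm, Complex.norm_exp_ofReal_mul_I]
  set p : ℂ := ∏ k, u k with hp
  have hp0 : p ≠ 0 := Finset.prod_ne_zero_iff.2 fun k _ => hu0 k
  -- only `exp (log u) = u` is used, so the choice of the branch plays no role
  have hexp : Complex.exp (-(n : ℂ) * ∑ k, Complex.log (u k)) = (p ^ n)⁻¹ := by
    rw [neg_mul, Complex.exp_neg, Complex.exp_nat_mul, Complex.exp_sum]
    simp only [Complex.exp_log (hu0 _), hp]
  -- the interaction is a signed square of the Vandermonde product, divided by a power of `∏ u`
  have hcirc : (circularInteraction θ : ℂ) * p ^ (n - 1) =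
      (-1) ^ (n * (n - 1) / 2) * vandermondeProd u ^ 2 := by
    rw [hp, ← prod_Ioi_mul_self, ← prod_Ioi_const, circularInteraction, vandermondeProd]
    simp only [← Finset.prod_pow, Complex.ofReal_prod, ← Finset.prod_mul_distrib]
    exact Finset.prod_congr rfl fun i _ => Finset.prod_congr rfl fun j _ =>
      norm_sub_sq_mul (hu1 i) (hu1 j)
  change _ * _ * ((vandermondeProd u ^ 2 * Complex.exp (-(n : ℂ) * ∑ k, Complex.log (u k))) *
    ∏ k, (Complex.I * u k)) = _
  rw [hexp, Finset.prod_mul_distrib, ← hp]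
  simp only [Finset.prod_const, Finset.card_univ, Fintype.card_fin]
  rcases n with _ | m
  · simp [vandermondeProd, circularInteraction, hp]
  have hI : Complex.I ^ (m + 1) * Complex.I ^ (m + 1) = (-1) ^ (m + 1) := by
    rw [← mul_pow, Complex.I_mul_I]
  have hsq : ∀ k : ℕ, ((-1 : ℂ) ^ k) * (-1) ^ k = 1 := fun k => by
    rw [← mul_pow]; simp
  have htri : (m + 1) * (m + 1 + 1) / 2 = (m + 1) * (m + 1 - 1) / 2 + (m + 1) := by
    have := Nat.triangle_succ (m + 1)
    simpa [mul_comm] using this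
  rw [htri, pow_add]
  set s : ℂ := (-1) ^ ((m + 1) * (m + 1 - 1) / 2) with hs
  set V := vandermondeProd u
  have hss : s * s = 1 := hsq _
  have hpm : p ^ (m + 1) = p ^ m * p := pow_succ _ _
  rw [Nat.add_sub_cancel] at hcirc
  have hpm0 : p ^ m ≠ 0 := pow_ne_zero _ hp0
  rw [hpm, mul_inv]
  have hV : V ^ 2 = s * ((circularInteraction θ : ℂ) * p ^ m) := by
    rw [hcirc, ← mul_assoc, hss, one_mul]
  rw [hV]
  calc s * (-1) ^ (m + 1) * Complex.I ^ (m + 1) *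
      (s * ((circularInteraction θ : ℂ) * p ^ m) * ((p ^ m)⁻¹ * p⁻¹) *
        (Complex.I ^ (m + 1) * p))
      = (s * s) * ((-1) ^ (m + 1) * (Complex.I ^ (m + 1) * Complex.I ^ (m + 1))) *
        (circularInteraction θ : ℂ) * (p ^ m * (p ^ m)⁻¹) * (p * p⁻¹) := by ring
    _ = _ := by
      rw [hss, hI, hsq, mul_inv_cancel₀ hpm0, mul_inv_cancel₀ hp0]; ring

theorem hermitianConst_eq (n : ℕ) : hermitianConst n =
    2 ^ (n ^ 2) / ((2 * Real.pi) ^ n * (n.factorial : ℝ)) * (1 / unitaryVolume n) := by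
  have h1 : n ^ 2 = n * (n - 1) + n := by
    cases n with
    | zero => rfl
    | succ m => simp; ring
  have h2 : n * (n + 1) / 2 = n * (n - 1) / 2 + n := by
    have := Nat.triangle_succ n
    rw [mul_comm]
    exact this
  rw [hermitianConst, unitaryVolume, h1, h2, pow_add, pow_add, mul_pow]
  have := Real.pi_pos
  have := Nat.factorial_pos n
  field_simp

/-! ### Unions of arcs -/

section arcs
variable {d : ℕ} {α β : Fin d → ℝ}

theorem isCompact_arcAngles (α β : Fin d → ℝ) : IsCompact (arcAngles α β) :=
  isCompact_iUnion fun _ => isCompact_Icc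

theorem isCompact_tanIntervals (α β : Fin d → ℝ) : IsCompact (tanIntervals α β) :=
  isCompact_iUnion fun _ => isCompact_Icc

theorem measurableSet_arcAngles (α β : Fin d → ℝ) : MeasurableSet (arcAngles α β) :=
  (isCompact_arcAngles α β).measurableSet

/-- Two closed intervals may share endpoints, and a degenerate one may lie inside another; in either
case the overlap is a null set. -/
theorem aedisjoint_Icc (hdisj : ∀ i j, i ≠ j → Disjoint (Set.Ioo (α i) (β i)) (Set.Ioo (α j) (β j)))
    {i j : Fin d} (hij : i ≠ j) :
    AEDisjoint volume (Set.Icc (α i) (β i)) (Set.Icc (α j) (β j)) :=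
  (hdisj i j hij).aedisjoint.congr Ioo_ae_eq_Icc.symm Ioo_ae_eq_Icc.symm

theorem arcAngles_subset (hα : ∀ j, -Real.pi < α j) (hβ : ∀ j, β j < Real.pi) :
    arcAngles α β ⊆ Set.Ioo (-Real.pi) Real.pi := by
  intro t ht
  obtain ⟨j, hj⟩ := Set.mem_iUnion.1 ht
  exact ⟨(hα j).trans_le hj.1, hj.2.trans_lt (hβ j)⟩

/-- On `[-π, π]` a point lies on the arcs exactly when its angle lies in the intervals; the
endpoints `±π` both give the point `-1`, which no arc contains. -/
theorem exp_mem_arcPoints_iff (hα : ∀ j, -Real.pi < α j) (hβ : ∀ j, β j < Real.pi) {θ : ℝ}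
    (hθ : θ ∈ Set.Icc (-Real.pi) Real.pi) :
    Complex.exp (Complex.I * (θ : ℂ)) ∈ arcPoints α β ↔ θ ∈ arcAngles α β := by
  simp only [arcPoints, arcAngles, Set.mem_iUnion, Set.mem_image]
  constructor
  · rintro ⟨j, t, ht, h⟩
    have hts : -Real.pi < t ∧ t < Real.pi := ⟨(hα j).trans_le ht.1, ht.2.trans_lt (hβ j)⟩
    -- the angles differ by a multiple of `2π`, and by less than `2π`
    obtain ⟨k, hk⟩ := Complex.exp_eq_exp_iff_exists_int.1 h
    have hk' : t = θ + k * (2 * Real.pi) := by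
      have h2 : Complex.I * ((t : ℂ) - (θ + k * (2 * Real.pi))) = 0 := by
        linear_combination hk
      have h3 := (mul_eq_zero.1 h2).resolve_left Complex.I_ne_zero
      exact_mod_cast sub_eq_zero.1 h3
    have hπ := Real.pi_pos
    have hk0 : k = 0 := by
      have h1 : (k : ℝ) < 1 := by
        by_contra hc
        have := mul_le_mul_of_nonneg_right (not_lt.1 hc) (by linarith : (0 : ℝ) ≤ 2 * Real.pi)
        linarith [hθ.1, hts.2]
      have h2 : (-1 : ℝ) < k := by
        by_contra hc
        have := mul_le_mul_of_nonneg_right (not_lt.1 hc) (by linarith : (0 : ℝ) ≤ 2 * Real.pi)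
        linarith [hθ.2, hts.1]
      have h1' : k < 1 := by exact_mod_cast h1
      have h2' : -1 < k := by exact_mod_cast h2
      omega
    rw [hk0] at hk'
    simp only [Int.cast_zero, zero_mul, add_zero] at hk'
    exact ⟨j, hk' ▸ ht⟩
  · rintro ⟨j, hj⟩
    exact ⟨j, θ, hj, rfl⟩

theorem arcSymbol_exp (hα : ∀ j, -Real.pi < α j) (hβ : ∀ j, β j < Real.pi) {θ : ℝ}
    (hθ : θ ∈ Set.Icc (-Real.pi) Real.pi) :
    arcSymbol α β (Complex.exp (Complex.I * (θ : ℂ))) =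
      (arcAngles α β).indicator (fun _ => 1) θ := by
  by_cases h : θ ∈ arcAngles α β
  · rw [arcSymbol, Set.indicator_of_mem h,
      Set.indicator_of_mem ((exp_mem_arcPoints_iff hα hβ hθ).2 h)]
  · rw [arcSymbol, Set.indicator_of_notMem h,
      Set.indicator_of_notMem (fun h' => h ((exp_mem_arcPoints_iff hα hβ hθ).1 h'))]

theorem integral_toeplitz_symbol (n : ℕ) (hα : ∀ j, -Real.pi < α j) (hβ : ∀ j, β j < Real.pi) :
    ∫ θ in Set.univ.pi (fun _ : Fin n => Set.Icc (-Real.pi) Real.pi),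
        (∏ k, arcSymbol α β (Complex.exp (Complex.I * (θ k : ℂ)))) * circularInteraction θ =
      ∫ θ in Set.univ.pi (fun _ : Fin n => arcAngles α β), circularInteraction θ := by
  have hA : MeasurableSet (Set.univ.pi fun _ : Fin n => Set.Icc (-Real.pi) Real.pi) :=
    MeasurableSet.univ_pi fun _ => measurableSet_Icc
  have hB : MeasurableSet (Set.univ.pi fun _ : Fin n => arcAngles α β) :=
    MeasurableSet.univ_pi fun _ => measurableSet_arcAngles α β
  have hsub : (Set.univ.pi fun _ : Fin n => arcAngles α β) ⊆
      Set.univ.pi fun _ : Fin n => Set.Icc (-Real.pi) Real.pi :=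
    Set.pi_mono fun _ _ => (arcAngles_subset hα hβ).trans Set.Ioo_subset_Icc_self
  rw [setIntegral_congr_fun hA (g := (Set.univ.pi fun _ : Fin n => arcAngles α β).indicator
    circularInteraction), setIntegral_indicator hB, Set.inter_eq_right.2 hsub]
  intro θ hθ
  have h : ∀ k, arcSymbol α β (Complex.exp (Complex.I * (θ k : ℂ))) =
      (arcAngles α β).indicator (fun _ => 1) (θ k) := fun k =>
    arcSymbol_exp hα hβ (hθ k (Set.mem_univ k))
  simp only [h]
  by_cases hm : ∀ k, θ k ∈ arcAngles α β
  · rw [Set.indicator_of_mem (by simpa using hm)]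
    simp [hm]
  · rw [Set.indicator_of_notMem (by simpa using hm)]
    push Not at hm
    obtain ⟨k, hk⟩ := hm
    rw [Finset.prod_eq_zero (Finset.mem_univ k), zero_mul]
    simp [hk]

theorem integral_arcSymbol_mul (hα : ∀ j, -Real.pi < α j) (hβ : ∀ j, β j < Real.pi) (g : ℝ → ℂ) :
    ∫ θ in Set.Icc (-Real.pi) Real.pi,
        (arcSymbol α β (Complex.exp (Complex.I * (θ : ℂ))) : ℂ) * g θ =
      ∫ θ in arcAngles α β, g θ := by
  rw [setIntegral_congr_fun measurableSet_Icc (g := (arcAngles α β).indicator g),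
    setIntegral_indicator (measurableSet_arcAngles α β),
    Set.inter_eq_right.2 ((arcAngles_subset hα hβ).trans Set.Ioo_subset_Icc_self)]
  intro θ hθ
  simp only [arcSymbol_exp hα hβ hθ]
  by_cases h : θ ∈ arcAngles α β <;> simp [h]

/-! ### The Toeplitz coefficients -/

theorem integral_exp_Icc {a b : ℝ} (hab : a ≤ b) {k : ℤ} (hk : k ≠ 0) :
    ∫ θ in Set.Icc a b, Complex.exp (Complex.I * (k : ℂ) * (θ : ℂ)) =
      Complex.exp (Complex.I * (k : ℂ) * (((a + b) / 2 : ℝ) : ℂ)) * ((b - a : ℝ) : ℂ) *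
        ((Real.sinc ((k : ℝ) * (b - a) / 2) : ℝ) : ℂ) := by
  rw [integral_Icc_eq_integral_Ioc, ← intervalIntegral.integral_of_le hab]
  rcases hab.eq_or_lt with rfl | hlt
  · simp
  have hk' : (k : ℂ) ≠ 0 := by exact_mod_cast hk
  have hkr : (k : ℝ) ≠ 0 := by exact_mod_cast hk
  have hba : b - a ≠ 0 := sub_ne_zero.2 hlt.ne'
  have hbac : (b : ℂ) - a ≠ 0 := by exact_mod_cast hba
  rw [integral_exp_mul_complex (mul_ne_zero Complex.I_ne_zero hk'),
    Real.sinc_of_ne_zero (by positivity)]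
  have h1 : Complex.exp (Complex.I * k * b) =
      Complex.exp (Complex.I * k * (((a + b) / 2 : ℝ) : ℂ)) *
      Complex.exp ((((k : ℝ) * (b - a) / 2 : ℝ) : ℂ) * Complex.I) := by
    rw [← Complex.exp_add]; congr 1; push_cast; ring
  have h2 : Complex.exp (Complex.I * k * a) =
      Complex.exp (Complex.I * k * (((a + b) / 2 : ℝ) : ℂ)) *
      Complex.exp (-(((k : ℝ) * (b - a) / 2 : ℝ) : ℂ) * Complex.I) := by
    rw [← Complex.exp_add]; congr 1; push_cast; ring
  have h3 : Complex.exp ((((k : ℝ) * (b - a) / 2 : ℝ) : ℂ) * Complex.I) -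
      Complex.exp (-(((k : ℝ) * (b - a) / 2 : ℝ) : ℂ) * Complex.I) =
      2 * Complex.I * ((Real.sin ((k : ℝ) * (b - a) / 2) : ℝ) : ℂ) := by
    rw [Complex.ofReal_sin, Complex.sin]
    linear_combination (Complex.exp (-(((k : ℝ) * (b - a) / 2 : ℝ) : ℂ) * Complex.I) -
      Complex.exp ((((k : ℝ) * (b - a) / 2 : ℝ) : ℂ) * Complex.I)) * (-Complex.I_sq)
  rw [h1, h2, ← mul_sub, h3]
  push_cast
  have := Complex.I_ne_zero
  field_simp

theorem integral_arcAngles_eq_sum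
    (hdisj : ∀ i j, i ≠ j → Disjoint (Set.Ioo (α i) (β i)) (Set.Ioo (α j) (β j))) {g : ℝ → ℂ}
    (hg : Continuous g) :
    ∫ θ in arcAngles α β, g θ = ∑ j, ∫ θ in Set.Icc (α j) (β j), g θ := by
  have h := integral_iUnion_ae (μ := volume) (f := g) (s := fun j => Set.Icc (α j) (β j))
    (fun j => measurableSet_Icc.nullMeasurableSet) (fun i j hij => aedisjoint_Icc hdisj hij)
    (hg.continuousOn.integrableOn_compact (isCompact_arcAngles α β))
  rw [tsum_fintype] at h
  exact h

theorem toeplitzCoeff_eq_integral (hαβ : ∀ j, α j ≤ β j)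
    (hdisj : ∀ i j, i ≠ j → Disjoint (Set.Ioo (α i) (β i)) (Set.Ioo (α j) (β j))) (k : ℤ) :
    toeplitzCoeff α β k = 1 / (2 * (Real.pi : ℂ)) *
      ∫ θ in arcAngles α β, Complex.exp (Complex.I * (k : ℂ) * (θ : ℂ)) := by
  rw [integral_arcAngles_eq_sum hdisj (by fun_prop), toeplitzCoeff]
  split_ifs with hk
  · subst hk
    congr 1
    refine Finset.sum_congr rfl fun j _ => ?_
    simp [hαβ j]
  · congr 1
    exact Finset.sum_congr rfl fun j _ => (integral_exp_Icc (hαβ j) hk).symm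

theorem toeplitzCoeff_zero (hαβ : ∀ j, α j ≤ β j)
    (hdisj : ∀ i j, i ≠ j → Disjoint (Set.Ioo (α i) (β i)) (Set.Ioo (α j) (β j))) :
    toeplitzCoeff α β 0 = ((volume.real (arcAngles α β) / (2 * Real.pi) : ℝ) : ℂ) := by
  rw [toeplitzCoeff_eq_integral hαβ hdisj]
  simp
  ring

/-! ### The Toeplitz determinant -/

theorem circularInteraction_eq_det_mul {n : ℕ} (θ : Fin n → ℝ) :
    (circularInteraction θ : ℂ) =
      (∑ σ : Equiv.Perm (Fin n), ((Equiv.Perm.sign σ : ℤ) : ℂ) *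
        ∏ k, Complex.exp (Complex.I * (θ k : ℂ)) ^ (σ k : ℕ)) *
      ∑ τ : Equiv.Perm (Fin n), ((Equiv.Perm.sign τ : ℤ) : ℂ) *
        ∏ k, Complex.exp (-(Complex.I * (θ k : ℂ))) ^ (τ k : ℕ) := by
  have hdet : ∀ z : Fin n → ℂ, (∑ σ : Equiv.Perm (Fin n), ((Equiv.Perm.sign σ : ℤ) : ℂ) *
      ∏ k, z k ^ (σ k : ℕ)) = (Matrix.vandermonde z).det := fun z => by
    rw [← Matrix.det_transpose, Matrix.det_apply']
    simp [Matrix.vandermonde_apply]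
  rw [hdet, hdet, Matrix.det_vandermonde, Matrix.det_vandermonde, circularInteraction,
    ← Finset.prod_mul_distrib, Complex.ofReal_prod]
  refine Finset.prod_congr rfl fun i _ => ?_
  rw [← Finset.prod_mul_distrib, Complex.ofReal_prod]
  refine Finset.prod_congr rfl fun j _ => ?_
  rw [← Complex.normSq_eq_norm_sq, ← Complex.mul_conj, map_sub, ← Complex.exp_conj,
    ← Complex.exp_conj]
  simp only [map_mul, Complex.conj_I, Complex.conj_ofReal, neg_mul]
  ring

/-- Heine's identity: the two determinants are expanded, and the integral of each product is a
product of Fourier coefficients. -/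
theorem circularIntegral_eq_det (n : ℕ) (hαβ : ∀ j, α j ≤ β j)
    (hdisj : ∀ i j, i ≠ j → Disjoint (Set.Ioo (α i) (β i)) (Set.Ioo (α j) (β j))) :
    (circularIntegral n (arcAngles α β) : ℂ) = (toeplitzMatrix n α β).det := by
  set T := toeplitzMatrix n α β with hT
  have hπ : (2 * (Real.pi : ℂ)) ≠ 0 := by
    simp
  have hterm : ∀ σ τ : Equiv.Perm (Fin n),
      ∫ θ in Set.univ.pi (fun _ : Fin n => arcAngles α β),
        (∏ k, Complex.exp (Complex.I * (θ k : ℂ)) ^ (σ k : ℕ)) *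
          ∏ k, Complex.exp (-(Complex.I * (θ k : ℂ))) ^ (τ k : ℕ) =
      (2 * (Real.pi : ℂ)) ^ n * ∏ k, T (σ k) (τ k) := by
    intro σ τ
    have h1 : ∀ θ : Fin n → ℝ, (∏ k, Complex.exp (Complex.I * (θ k : ℂ)) ^ (σ k : ℕ)) *
          ∏ k, Complex.exp (-(Complex.I * (θ k : ℂ))) ^ (τ k : ℕ) =
        ∏ k, Complex.exp (Complex.I * (((σ k : ℤ) - (τ k : ℤ) : ℤ) : ℂ) * (θ k : ℂ)) := by
      intro θ
      rw [← Finset.prod_mul_distrib]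
      refine Finset.prod_congr rfl fun k _ => ?_
      rw [← Complex.exp_nat_mul, ← Complex.exp_nat_mul, ← Complex.exp_add]
      congr 1
      push_cast
      ring
    simp only [h1]
    rw [volume_pi, Measure.restrict_pi_pi, integral_fintype_prod_eq_prod (fun (k : Fin n) (t : ℝ) =>
      Complex.exp (Complex.I * (((σ k : ℤ) - (τ k : ℤ) : ℤ) : ℂ) * (t : ℂ)))]
    have h2 : ∀ k, ∫ t in arcAngles α β,
        Complex.exp (Complex.I * (((σ k : ℤ) - (τ k : ℤ) : ℤ) : ℂ) * (t : ℂ)) =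
        (2 * (Real.pi : ℂ)) * T (σ k) (τ k) := by
      intro k
      rw [hT, toeplitzMatrix, Matrix.of_apply, toeplitzCoeff_eq_integral hαβ hdisj]
      field_simp
    simp only [h2]
    rw [Finset.prod_mul_distrib]
    simp
  have hint : ∀ σ τ : Equiv.Perm (Fin n), IntegrableOn (fun θ : Fin n → ℝ =>
      (((Equiv.Perm.sign σ : ℤ) : ℂ) * ((Equiv.Perm.sign τ : ℤ) : ℂ)) *
      ((∏ k, Complex.exp (Complex.I * (θ k : ℂ)) ^ (σ k : ℕ)) *
          ∏ k, Complex.exp (-(Complex.I * (θ k : ℂ))) ^ (τ k : ℕ)))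
      (Set.univ.pi fun _ : Fin n => arcAngles α β) := by
    intro σ τ
    refine Continuous.continuousOn (by fun_prop) |>.integrableOn_compact
      (isCompact_univ_pi fun _ => isCompact_arcAngles α β)
  have hI : ((∫ θ in Set.univ.pi (fun _ : Fin n => arcAngles α β), circularInteraction θ : ℝ) : ℂ) =
      (2 * (Real.pi : ℂ)) ^ n * ((n.factorial : ℂ) * T.det) := by
    rw [← integral_complex_ofReal]
    have hexp : ∀ θ : Fin n → ℝ, (circularInteraction θ : ℂ) =
        ∑ τ : Equiv.Perm (Fin n), ∑ σ : Equiv.Perm (Fin n),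
          (((Equiv.Perm.sign σ : ℤ) : ℂ) * ((Equiv.Perm.sign τ : ℤ) : ℂ)) *
          ((∏ k, Complex.exp (Complex.I * (θ k : ℂ)) ^ (σ k : ℕ)) *
            ∏ k, Complex.exp (-(Complex.I * (θ k : ℂ))) ^ (τ k : ℕ)) := by
      intro θ
      rw [circularInteraction_eq_det_mul, Finset.mul_sum]
      refine Finset.sum_congr rfl fun τ _ => ?_
      rw [Finset.sum_mul]
      refine Finset.sum_congr rfl fun σ _ => ?_
      ring
    simp only [hexp]
    rw [integral_finsetSum _ fun τ _ => integrable_finsetSum _ fun σ _ => hint σ τ]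
    have hτ : ∀ τ : Equiv.Perm (Fin n), ∫ θ in Set.univ.pi (fun _ : Fin n => arcAngles α β),
        ∑ σ : Equiv.Perm (Fin n),
          (((Equiv.Perm.sign σ : ℤ) : ℂ) * ((Equiv.Perm.sign τ : ℤ) : ℂ)) *
          ((∏ k, Complex.exp (Complex.I * (θ k : ℂ)) ^ (σ k : ℕ)) *
            ∏ k, Complex.exp (-(Complex.I * (θ k : ℂ))) ^ (τ k : ℕ)) =
        (2 * (Real.pi : ℂ)) ^ n * T.det := by
      intro τ
      rw [integral_finsetSum _ fun σ _ => hint σ τ]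
      simp only [integral_const_mul, hterm]
      have hperm := Matrix.det_permute' τ T
      rw [Matrix.det_apply'] at hperm
      simp only [Matrix.submatrix_apply, id] at hperm
      have hsign : (((Equiv.Perm.sign τ : ℤ) : ℂ) * ((Equiv.Perm.sign τ : ℤ) : ℂ)) = 1 := by
        rcases Int.units_eq_one_or (Equiv.Perm.sign τ) with h | h <;> simp [h]
      -- permuting the columns of `T` by `τ` produces a second factor `sign τ`
      calc _ = (2 * (Real.pi : ℂ)) ^ n * ((Equiv.Perm.sign τ : ℤ) : ℂ) *
            ∑ σ : Equiv.Perm (Fin n), ((Equiv.Perm.sign σ : ℤ) : ℂ) * ∏ k, T (σ k) (τ k) := by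
            rw [Finset.mul_sum]
            exact Finset.sum_congr rfl fun σ _ => by ring
        _ = _ := by
            rw [hperm, mul_assoc, ← mul_assoc (((Equiv.Perm.sign τ : ℤ) : ℂ)), hsign, one_mul]
    simp only [hτ]
    simp only [Finset.sum_const, Finset.card_univ, Fintype.card_perm, Fintype.card_fin,
      nsmul_eq_mul]
    ring
  have hfac : (n.factorial : ℂ) ≠ 0 := by exact_mod_cast n.factorial_ne_zero
  have hπn := pow_ne_zero n hπ
  rw [circularIntegral, Complex.ofReal_mul, hI]
  push_cast
  field_simp

/-! ### The integral over tangents -/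

theorem two_arctan_image (hαβ : ∀ j, α j ≤ β j)
    (hα : ∀ j, -Real.pi < α j) (hβ : ∀ j, β j < Real.pi) :
    (fun t => 2 * Real.arctan t) '' tanIntervals α β = arcAngles α β := by
  ext θ
  simp only [tanIntervals, arcAngles, Set.mem_image, Set.mem_iUnion]
  have hinv : ∀ x : ℝ, -Real.pi < x → x < Real.pi → Real.arctan (Real.tan (x / 2)) = x / 2 :=
    fun x h1 h2 => Real.arctan_tan (by linarith) (by linarith)
  constructor
  · rintro ⟨t, ⟨j, h1, h2⟩, rfl⟩
    have h1' := Real.arctan_strictMono.monotone h1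
    have h2' := Real.arctan_strictMono.monotone h2
    rw [hinv _ (hα j) ((hαβ j).trans_lt (hβ j))] at h1'
    rw [hinv _ ((hα j).trans_le (hαβ j)) (hβ j)] at h2'
    exact ⟨j, by linarith, by linarith⟩
  · rintro ⟨j, h1, h2⟩
    have ha := hα j
    have hb := hβ j
    refine ⟨Real.tan (θ / 2), ⟨j, ?_, ?_⟩, ?_⟩
    · exact Real.strictMonoOn_tan.monotoneOn ⟨by linarith, by linarith⟩
        ⟨by linarith, by linarith⟩ (by linarith)
    · exact Real.strictMonoOn_tan.monotoneOn ⟨by linarith, by linarith⟩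
        ⟨by linarith, by linarith⟩ (by linarith)
    · rw [hinv θ (by linarith) (by linarith)]
      ring

/-- The substitution `θ = 2 arctan t` has a diagonal derivative with entries `2 / (1 + t k ^ 2)`. -/
theorem integral_circularInteraction_tan (n : ℕ) (hαβ : ∀ j, α j ≤ β j)
    (hα : ∀ j, -Real.pi < α j) (hβ : ∀ j, β j < Real.pi) :
    ∫ θ in Set.univ.pi (fun _ : Fin n => arcAngles α β), circularInteraction θ =
      2 ^ (n ^ 2) * ∫ t in Set.univ.pi (fun _ : Fin n => tanIntervals α β),
        vandermondeProd t ^ 2 * ((∏ k, (1 + t k ^ 2)) ^ n)⁻¹ := by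
  set f : (Fin n → ℝ) → Fin n → ℝ := fun t k => 2 * Real.arctan (t k) with hf
  have himg : f '' (Set.univ.pi fun _ : Fin n => tanIntervals α β) =
      Set.univ.pi fun _ : Fin n => arcAngles α β := by
    have := Set.piMap_image_univ_pi (fun (_ : Fin n) (t : ℝ) => 2 * Real.arctan t)
      (fun _ => tanIntervals α β)
    rw [two_arctan_image hαβ hα hβ] at this
    exact this
  have hm : MeasurableSet (Set.univ.pi fun _ : Fin n => tanIntervals α β) :=
    MeasurableSet.univ_pi fun _ => (isCompact_tanIntervals α β).measurableSet
  set f' : (Fin n → ℝ) → (Fin n → ℝ) →L[ℝ] (Fin n → ℝ) := fun t =>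
    ContinuousLinearMap.pi fun k =>
      ((2 * (1 / (1 + t k ^ 2))) • ContinuousLinearMap.id ℝ ℝ).comp
        (ContinuousLinearMap.proj k) with hf'
  have hderiv : ∀ t, HasFDerivAt f (f' t) t := by
    intro t
    refine hasFDerivAt_pi.2 fun k => ?_
    have h1 := ((Real.hasDerivAt_arctan (t k)).const_mul 2).comp_hasFDerivAt t
      (hasFDerivAt_apply (𝕜 := ℝ) k t)
    refine h1.congr_fderiv ?_
    ext v
    simp
  have hdet : ∀ t, |(f' t).det| = 2 ^ n * (∏ k, (1 + t k ^ 2))⁻¹ := by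
    intro t
    rw [hf', ContinuousLinearMap.det_pi]
    have h1 : ∀ c : ℝ, (c • ContinuousLinearMap.id ℝ ℝ).det = c := fun c => by
      simp [ContinuousLinearMap.det]
    simp only [h1]
    rw [Finset.prod_mul_distrib, abs_of_nonneg (by positivity)]
    simp [Finset.prod_inv_distrib]
  have hinj : Function.Injective f := fun s t h => funext fun k => by
    have := congrFun h k
    simp only [hf] at this
    exact Real.arctan_injective (by linarith)
  rw [← himg, integral_image_eq_integral_abs_det_fderiv_smul volume hm
    (fun t _ => (hderiv t).hasFDerivWithinAt) hinj.injOn, ← integral_const_mul]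
  refine integral_congr_ae (Filter.Eventually.of_forall fun t => ?_)
  simp only [hdet, hf, circularInteraction_two_arctan, smul_eq_mul]
  rcases n with _ | m
  · simp
  have hsq : (m + 1) ^ 2 = (m + 1) * (m + 1 - 1) + (m + 1) := by simp; ring
  rw [hsq, pow_add, Nat.add_sub_cancel, pow_succ (∏ k, (1 + t k ^ 2)), mul_inv]
  ring

/-! ### The contour integral -/

theorem continuous_circularInteraction (n : ℕ) :
    Continuous (circularInteraction : (Fin n → ℝ) → ℝ) := by
  unfold circularInteraction
  fun_prop

theorem univ_pi_arcAngles (n : ℕ) (α β : Fin d → ℝ) :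
    Set.univ.pi (fun _ : Fin n => arcAngles α β) =
      ⋃ σ : Fin n → Fin d, Set.univ.pi fun k => Set.Icc (α (σ k)) (β (σ k)) := by
  ext θ
  simp only [arcAngles, Set.mem_univ_pi, Set.mem_iUnion]
  exact Classical.skolem

theorem aedisjoint_boxes {n : ℕ}
    (hdisj : ∀ i j, i ≠ j → Disjoint (Set.Ioo (α i) (β i)) (Set.Ioo (α j) (β j)))
    {σ τ : Fin n → Fin d} (hne : σ ≠ τ) :
    AEDisjoint volume (Set.univ.pi fun k => Set.Icc (α (σ k)) (β (σ k)))
      (Set.univ.pi fun k => Set.Icc (α (τ k)) (β (τ k))) := by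
  obtain ⟨k, hk⟩ := Function.ne_iff.1 hne
  rw [AEDisjoint, ← Set.pi_inter_distrib, volume_pi_pi]
  exact Finset.prod_eq_zero (Finset.mem_univ k) (aedisjoint_Icc hdisj hk)

/-- The boxes of arcs overlap in null sets, so that their integrals add up to the integral over
`I^n`. -/
theorem arcContourIntegral_eq (n : ℕ)
    (hdisj : ∀ i j, i ≠ j → Disjoint (Set.Ioo (α i) (β i)) (Set.Ioo (α j) (β j))) :
    (-1) ^ (n * (n + 1) / 2) * Complex.I ^ n *
        arcContourIntegral n α β (fun u =>
          vandermondeProd u ^ 2 * Complex.exp (-(n : ℂ) * ∑ k, Complex.log (u k))) =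
      ((∫ θ in Set.univ.pi (fun _ : Fin n => arcAngles α β), circularInteraction θ : ℝ) : ℂ) := by
  rw [arcContourIntegral, Finset.mul_sum, ← integral_complex_ofReal]
  simp only [← integral_const_mul, contour_integrand]
  rw [univ_pi_arcAngles, integral_iUnion_ae, tsum_fintype]
  · exact fun σ => (MeasurableSet.univ_pi fun _ => measurableSet_Icc).nullMeasurableSet
  · exact fun σ τ hne => aedisjoint_boxes hdisj hne
  · rw [← univ_pi_arcAngles]
    exact (Complex.continuous_ofReal.comp
      (continuous_circularInteraction n)).continuousOn.integrableOn_compact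
      (isCompact_univ_pi fun _ => isCompact_arcAngles α β)

end arcs

end

theorem mainTheorem8 (n d : ℕ) (α β : Fin d → ℝ)
    (hαβ : ∀ j, α j ≤ β j)
    (hα : ∀ j, -Real.pi < α j) (hβ : ∀ j, β j < Real.pi)
    (hdisj : ∀ i j, i ≠ j → Disjoint (Set.Ioo (α i) (β i)) (Set.Ioo (α j) (β j))) :
    -- the circular integral with the indicator symbol
    circularIntegral n (arcAngles α β) =
        1 / ((2 * Real.pi) ^ n * (n.factorial : ℝ)) *
          ∫ θ in Set.univ.pi (fun _ : Fin n => Set.Icc (-Real.pi) Real.pi),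
            (∏ k, arcSymbol α β (Complex.exp (Complex.I * (θ k : ℂ)))) * circularInteraction θ ∧
    -- the Toeplitz determinant, its coefficients being the Fourier coefficients of the symbol
    (circularIntegral n (arcAngles α β) : ℂ) = (toeplitzMatrix n α β).det ∧
    toeplitzCoeff α β 0 = ((volume.real (arcAngles α β) / (2 * Real.pi) : ℝ) : ℂ) ∧
    (∀ k : ℤ, toeplitzCoeff α β k =
        1 / (2 * (Real.pi : ℂ)) * ∫ θ in Set.Icc (-Real.pi) Real.pi,
          (arcSymbol α β (Complex.exp (Complex.I * (θ : ℂ))) : ℂ) *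
            Complex.exp (Complex.I * (k : ℂ) * (θ : ℂ))) ∧
    -- the real integrals
    circularIntegral n (arcAngles α β) =
        2 ^ (n * (n - 1)) / ((2 * Real.pi) ^ n * (n.factorial : ℝ)) *
          ∫ θ in Set.univ.pi (fun _ : Fin n => arcAngles α β),
            ∏ i, ∏ j ∈ Finset.Ioi i, Real.sin ((θ i - θ j) / 2) ^ 2 ∧
    circularIntegral n (arcAngles α β) =
        2 ^ (n ^ 2) / ((2 * Real.pi) ^ n * (n.factorial : ℝ)) *
          ∫ t in Set.univ.pi (fun _ : Fin n => tanIntervals α β),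
            vandermondeProd t ^ 2 * Real.exp (-(n : ℝ) * ∑ k, Real.log (1 + t k ^ 2)) ∧
    -- the Hermitian matrix integral and its constant
    (circularIntegral n (arcAngles α β) : ℂ) =
        (hermitianConst n : ℂ) *
          ∫ M in hermitianWithSpectrumIn n (tanIntervals α β),
            1 / (1 + M ^ 2).det ^ n ∂(hermitianLebesgue n) ∧
    hermitianConst n =
        2 ^ (n ^ 2) / ((2 * Real.pi) ^ n * (n.factorial : ℝ)) * (1 / unitaryVolume n) ∧
    -- the contour integral over the arcs
    (circularIntegral n (arcAngles α β) : ℂ) =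
        1 / ((2 * (Real.pi : ℂ)) ^ n * (n.factorial : ℂ)) *
          ((-1) ^ (n * (n + 1) / 2) * Complex.I ^ n *
            arcContourIntegral n α β (fun u =>
              vandermondeProd u ^ 2 * Complex.exp (-(n : ℂ) * ∑ k, Complex.log (u k)))) := by
  have hint := integral_circularInteraction_tan n hαβ hα hβ
  refine ⟨?_, circularIntegral_eq_det n hαβ hdisj, toeplitzCoeff_zero hαβ hdisj, fun k => ?_, ?_,
    ?_, ?_, hermitianConst_eq n, ?_⟩
  · rw [integral_toeplitz_symbol n hα hβ, circularIntegral]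
  · rw [integral_arcSymbol_mul hα hβ, toeplitzCoeff_eq_integral hαβ hdisj]
  · simp only [circularIntegral, circularInteraction_eq_sin]
    rw [integral_const_mul]
    ring
  · simp only [exp_neg_mul_sum_log]
    rw [circularIntegral, hint]
    ring
  · rw [integral_hermitianWithSpectrumIn n (isCompact_tanIntervals α β), circularIntegral, hint,
      hermitianConst_eq, ← Complex.ofReal_mul]
    congr 1
    have := (unitaryVolume_pos n).ne'
    field_simp
  · rw [arcContourIntegral_eq n hdisj, circularIntegral]
    push_cast
    ring
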